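/- **Formal systems.** Fix variables $x_1,x_2,\dots$ A formal mathematical system $M$ consists of a set $A$ of constant and function symbols, a set $P$ of predicate symbols (all with fixed arities) and a set $B$ of basis axioms, which are formulas in these symbols. Its terms are generated from the variables by the symbols in $A$; its formulas are built from equations $s\sim t$ and prime formulas $p(t_1,\dots,t_n)$, $p\in P$, by $\neg,\to,\wedge,\vee,\leftrightarrow,\forall x,\exists x$. Let $\Pi(M)$ be the set of formulas of $M$ that are provable in the Hilbert calculus with equality, with the axioms: the formulas in $B$; all instances of propositional tautologies; the axioms of equality; $\forall x F\to F$; $\forall x(F\to G)\to(F\to\forall xG)$ for $x$ not free in $F$; $\exists xF\leftrightarrow\neg\forall x\neg F$; and with the rules modus ponens, collision-free substitution of terms for free variables, and generalization $F/\forall xF$. A system $M'$ is an *extension* of $M$ if $A\subseteq A'$, $P\subseteq P'$, every term of $M$ is a term of $M'$, and $\Pi(M)\subseteq\Pi(M')$. It is a *conservative* extension if moreover every formula of $M$ in $\Pi(M')$ is in $\Pi(M)$. **RST.** The system RST has the single symbol $\in$ (binary) and the following basis axioms, for all choices of distinct variables $t,u,v,w,x,y,z$. - Extensionality: $\forall y(y\in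 u\leftrightarrow y\in v)\to u\sim v$. - Subset axioms: $\exists u\forall y(y\in u\leftrightarrow y\in x\wedge F)$ for all formulas $F$ of RST in which $u,x$ do not occur. - Regularity: $\exists y\,y\in u\to\exists y(y\in u\wedge\neg\exists z(z\in u\wedge z\in y))$. - Pairing: $\exists u(x\in u\wedge y\in u)$. - Subset-friendly sets: $\exists u$ such that $x\in u$; and $\forall y(y\in u\to\forall z(z\in y\to z\in u))$; and $\forall y(y\in u\to\exists z(z\in u\wedge\forall v(v\in z\leftrightarrow\forall w(w\in v\to w\in y))))$; and $\forall y(y\in u\to\forall z(z\in u\to\exists v(v\in u\wedge y\in v\wedge z\in v\wedge\forall w(w\in v\to\forall t(t\in w\to t\in v)))))$. - Choice: if $\forall x(x\in u\to\exists w\,w\in x)$ and $\forall x\forall y(x\in u\to(y\in u\to(\exists w(w\in x\wedge w\in y)\to x\sim y)))$, then $\exists y\forall x(x\in u\to\exists v(v\in x\wedge v\in y\wedge\forall w(w\in x\wedge w\in y\to v\sim w)))$. **sf-theories.** An extension $M$ of RST (RST included) is a *subset-friendly theory* (*sf-theory*) if $\exists u\forall y(y\in u\leftrightarrow y\in x\wedge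 F)\in\Pi(M)$ for all distinct variables $x,y,u$ and all formulas $F$ of $M$ in which $u,x$ do not occur. **RST$_{ext}$** results from RST by adding the constant $\emptyset$, the binary predicate symbol $\subseteq$, the unary function symbols $\cup,\sigma,\mathcal P$, the binary function symbol $\sigma_2$, and the following axioms, for all choices of distinct variables: - $u\sim\emptyset\leftrightarrow\forall y\,\neg\,y\in u$; - $u\subseteq v\leftrightarrow\forall y(y\in u\to y\in v)$; - $u\sim\cup(x)\leftrightarrow\forall z(z\in u\leftrightarrow\exists y(z\in y\wedge y\in x))$; - $u\sim\sigma(x)\leftrightarrow\forall y(y\in u\leftrightarrow y\sim x)$; - $u\sim\sigma_2(x,y)\leftrightarrow\forall z(z\in u\leftrightarrow z\sim x\vee z\sim y)$; - $z\sim\mathcal P(x)\leftrightarrow\forall v(v\in z\leftrightarrow\forall w(w\in v\to w\in x))$. **Theorem.** RST$_{ext}$ is an sf-theory and a conservative extension of RST. RST is itself an sf-theory. The following formulas are provable in RST and, more generally, in every sf-theory, for all distinct variables $x,y,z,u,v,w$: (a) (empty set) $\exists u\forall y(y\in u\leftrightarrow y\in x\wedge\neg\,y\in x)$ and $\exists u\forall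 y\,\neg\,y\in u$; (b) (unions) $\exists u\forall z(z\in u\leftrightarrow\exists y(z\in y\wedge y\in x))$; (c) (pair sets) $\exists u\forall z(z\in u\leftrightarrow z\sim x\vee z\sim y)$; (d) (power sets) $\exists z\forall v(v\in z\leftrightarrow\forall w(w\in v\to w\in x))$; (e) (inductive set) $\exists x\big(\exists y(y\in x\wedge\forall z\,\neg\,z\in y)\wedge\forall y(y\in x\to\exists z(z\in x\wedge\forall v(v\in z\leftrightarrow v\in y\vee v\sim y)))\big)$. Consequently every axiom of ZFC for sets other than replacement is provable in RST: extensionality, regularity and choice as above, the second formula of (a), the formulas (b)–(e), and $\exists u\forall y(y\in u\leftrightarrow y\in x\wedge F)$ for all distinct $x,y,u$ and all formulas $F$ of RST in which $u$ is not free. -/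

import Mathlib

universe u v

namespace SetTh

/-- Formulas over a signature `L`, with the variables `x₁, x₂, …` indexed by `ℕ`, with named bound
variables, and with all connectives and both quantifiers primitive. Terms are those of Mathlib. -/
inductive Form (L : FirstOrder.Language.{u, v}) : Type (max u v)
  | eq (s t : L.Term ℕ) : Form L
  | rel {n : ℕ} (p : L.Relations n) (ts : Fin n → L.Term ℕ) : Form L
  | neg (F : Form L) : Form L
  | imp (F G : Form L) : Form L
  | and (F G : Form L) : Form L
  | or (F G : Form L) : Form L
  | iff (F G : Form L) : Form L
  | all (x : ℕ) (F : Form L) : Form L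
  | ex (x : ℕ) (F : Form L) : Form L

section Basics

variable {L : FirstOrder.Language.{u, v}}

/-- The variables occurring in a term. -/
def termVar : L.Term ℕ → Set ℕ
  | .var x => {x}
  | .func _ ts => ⋃ i, termVar (ts i)

/-- The terms generated by the variables and by the symbols in `A`. -/
def TermOver (A : Set (Σ n, L.Functions n)) : L.Term ℕ → Prop
  | .var _ => True
  | .func f ts => (⟨_, f⟩ : Σ n, L.Functions n) ∈ A ∧ ∀ i, TermOver A (ts i)

/-- The term obtained from `t` by replacing the variable `x` by `s`. -/
def termSubst (t : L.Term ℕ) (x : ℕ) (s : L.Term ℕ) : L.Term ℕ :=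
  t.subst (Function.update FirstOrder.Language.Term.var x s)

namespace Form

/-- All variables occurring in a formula, free or bound, including the quantified ones. -/
def var : Form L → Set ℕ
  | eq s t => termVar s ∪ termVar t
  | rel _ ts => ⋃ i, termVar (ts i)
  | neg F => F.var
  | imp F G => F.var ∪ G.var
  | and F G => F.var ∪ G.var
  | or F G => F.var ∪ G.var
  | iff F G => F.var ∪ G.var
  | all x F => insert x F.var
  | ex x F => insert x F.var

/-- The variables with a free occurrence in a formula. -/
def free : Form L → Set ℕ
  | eq s t => termVar s ∪ termVar t
  | rel _ ts => ⋃ i, termVar (ts i)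
  | neg F => F.free
  | imp F G => F.free ∪ G.free
  | and F G => F.free ∪ G.free
  | or F G => F.free ∪ G.free
  | iff F G => F.free ∪ G.free
  | all x F => F.free \ {x}
  | ex x F => F.free \ {x}

/-- The formulas whose function symbols lie in `A` and whose predicate symbols lie in `P`. -/
def Over (A : Set (Σ n, L.Functions n)) (P : Set (Σ n, L.Relations n)) : Form L → Prop
  | eq s t => TermOver A s ∧ TermOver A t
  | rel p ts => (⟨_, p⟩ : Σ n, L.Relations n) ∈ P ∧ ∀ i, TermOver A (ts i)
  | neg F => F.Over A P
  | imp F G => F.Over A P ∧ G.Over A P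
  | and F G => F.Over A P ∧ G.Over A P
  | or F G => F.Over A P ∧ G.Over A P
  | iff F G => F.Over A P ∧ G.Over A P
  | all _ F => F.Over A P
  | ex _ F => F.Over A P

/-- `F.subst x s` results from `F` by replacing the free occurrences of `x` by the term `s`. -/
def subst (x : ℕ) (s : L.Term ℕ) : Form L → Form L
  | eq t₁ t₂ => eq (termSubst t₁ x s) (termSubst t₂ x s)
  | rel p ts => rel p (fun i => termSubst (ts i) x s)
  | neg F => neg (F.subst x s)
  | imp F G => imp (F.subst x s) (G.subst x s)
  | and F G => and (F.subst x s) (G.subst x s)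
  | or F G => or (F.subst x s) (G.subst x s)
  | iff F G => iff (F.subst x s) (G.subst x s)
  | all y F => if y = x then all y F else all y (F.subst x s)
  | ex y F => if y = x then ex y F else ex y (F.subst x s)

/-- Replacing the free occurrences of `x` by `s` is collision-free: no variable of `s` gets
bound by a quantifier of the formula. -/
def CollisionFree (x : ℕ) (s : L.Term ℕ) : Form L → Prop
  | eq _ _ => True
  | rel _ _ => True
  | neg F => F.CollisionFree x s
  | imp F G => F.CollisionFree x s ∧ G.CollisionFree x s
  | and F G => F.CollisionFree x s ∧ G.CollisionFree x s
  | or F G => F.CollisionFree x s ∧ G.CollisionFree x s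
  | iff F G => F.CollisionFree x s ∧ G.CollisionFree x s
  | all y F => x ∉ (all y F).free ∨ (y ∉ termVar s ∧ F.CollisionFree x s)
  | ex y F => x ∉ (ex y F).free ∨ (y ∉ termVar s ∧ F.CollisionFree x s)

/-- The truth value of a formula as a propositional combination of prime formulas and quantified
formulas, whose truth values are given by `τ`. -/
def propTruth (τ : Form L → Prop) : Form L → Prop
  | neg F => ¬ F.propTruth τ
  | imp F G => F.propTruth τ → G.propTruth τ
  | and F G => F.propTruth τ ∧ G.propTruth τ
  | or F G => F.propTruth τ ∨ G.propTruth τ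
  | iff F G => F.propTruth τ ↔ G.propTruth τ
  | eq s t => τ (eq s t)
  | rel p ts => τ (rel p ts)
  | all x F => τ (all x F)
  | ex x F => τ (ex x F)

/-- Substitution instances of identically true propositional functions. -/
def IsTautology (F : Form L) : Prop := ∀ τ : Form L → Prop, F.propTruth τ

/-- The iterated implication `H₀ → (H₁ → … → (Hₙ₋₁ → C))`. -/
def impChain {n : ℕ} (H : Fin n → Form L) (C : Form L) : Form L :=
  (List.ofFn H).foldr imp C

/-- The equation `x = y` between variables. -/
def eqv (x y : ℕ) : Form L := eq (FirstOrder.Language.Term.var x) (FirstOrder.Language.Term.var y)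

end Form

end Basics

/-- A formal mathematical system `[M; 𝓛]`, `M = [A; P; B]`, with symbols taken from a signature `L`:
a set `A` of constant and function symbols, a set `P` of predicate symbols, and a set `B` of basis
axioms, which are formulas in these symbols. The set `𝓛` of terms is the one generated by `A`. -/
structure System (L : FirstOrder.Language.{u, v}) where
  A : Set (Σ n, L.Functions n)
  P : Set (Σ n, L.Relations n)
  B : Set (Form L)
  basis_over : ∀ F ∈ B, F.Over A P

namespace System

variable {L : FirstOrder.Language.{u, v}}

/-- The terms of the system. -/
def terms (M : System L) : Set (L.Term ℕ) := {t | TermOver M.A t}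

/-- The formulas of the system. -/
def formulas (M : System L) : Set (Form L) := {F | F.Over M.A M.P}

open Form in
/-- Provability in the Hilbert calculus for predicate logic with equality. -/
inductive Provable (M : System L) : Form L → Prop
  | basis {F : Form L} : F ∈ M.B → Provable M F
  -- the propositional calculus
  | taut {F : Form L} : F ∈ M.formulas → F.IsTautology → Provable M F
  -- equality
  | eqRefl (x : ℕ) : Provable M (eqv x x)
  | eqEq (x x₁ y y₁ : ℕ) :
      Provable M (imp (eqv x x₁) (imp (eqv y y₁) (imp (eqv x y) (eqv x₁ y₁))))
  | eqFun {n : ℕ} (f : L.Functions n) (xs ys : Fin n → ℕ) : ⟨n, f⟩ ∈ M.A →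
      Provable M (impChain (fun i => eqv (xs i) (ys i))
        (eq (.func f fun i => .var (xs i)) (.func f fun i => .var (ys i))))
  | eqRel {n : ℕ} (p : L.Relations n) (xs ys : Fin n → ℕ) : ⟨n, p⟩ ∈ M.P →
      Provable M (impChain (fun i => eqv (xs i) (ys i))
        (imp (rel p fun i => .var (xs i)) (rel p fun i => .var (ys i))))
  -- quantifiers
  | allElim (x : ℕ) {F : Form L} : F ∈ M.formulas → Provable M (imp (all x F) F)
  | allImp (x : ℕ) {F G : Form L} : F ∈ M.formulas → G ∈ M.formulas → x ∉ F.free →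
      Provable M (imp (all x (imp F G)) (imp F (all x G)))
  | exIff (x : ℕ) {F : Form L} : F ∈ M.formulas →
      Provable M (iff (ex x F) (neg (all x (neg F))))
  -- modus ponens, collision-free substitution, generalization
  | mp {F G : Form L} : Provable M F → Provable M (imp F G) → Provable M G
  | subst {F : Form L} (x : ℕ) (s : L.Term ℕ) : Provable M F → s ∈ M.terms →
      F.CollisionFree x s → Provable M (F.subst x s)
  | gen (x : ℕ) {F : Form L} : Provable M F → Provable M (all x F)

/-- `Π(M; 𝓛)`. -/
def provables (M : System L) : Set (Form L) := {F | M.Provable F}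

/-- `M'` is an extension of `M`. -/
def IsExtension (M M' : System L) : Prop :=
  M.A ⊆ M'.A ∧ M.P ⊆ M'.P ∧ M.terms ⊆ M'.terms ∧ M.provables ⊆ M'.provables

/-- `M'` is a conservative extension of `M`. -/
def IsConservativeExtension (M M' : System L) : Prop :=
  M.IsExtension M' ∧ ∀ F ∈ M.formulas, F ∈ M'.provables → F ∈ M.provables

end System

/-- The symbols `∅`, `∪`, `σ` (singleton), `σ₂` (pair), `𝒫` with their arities. -/
inductive SetFun : ℕ → Type
  | empty : SetFun 0
  | union : SetFun 1
  | sing : SetFun 1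
  | pair : SetFun 2
  | pow : SetFun 1

/-- The binary symbols `∈` and `⊆`. -/
inductive SetRel : ℕ → Type
  | mem : SetRel 2
  | sub : SetRel 2

/-- The signature from which symbols are taken: the set-theoretic symbols, and arbitrary further
symbols given by `L₀`. A system uses only the symbols in its own sets `A` and `P`. -/
abbrev Sig (L₀ : FirstOrder.Language.{u, v}) : FirstOrder.Language.{u, v} :=
  FirstOrder.Language.sum ⟨SetFun, SetRel⟩ L₀

section SetTheory

variable {L₀ : FirstOrder.Language.{u, v}}

/-- A set-theoretic function symbol as a symbol of `Sig L₀`. -/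
def fn {n : ℕ} (f : SetFun n) : (Sig L₀).Functions n := Sum.inl f

/-- A set-theoretic predicate symbol as a symbol of `Sig L₀`. -/
def pr {n : ℕ} (p : SetRel n) : (Sig L₀).Relations n := Sum.inl p

open Form

/-- The prime formula `∈ x,y`. -/
def mem (x y : ℕ) : Form (Sig L₀) := rel (pr .mem) ![.var x, .var y]

/-- The prime formula `⊆ x,y`. -/
def sub (x y : ℕ) : Form (Sig L₀) := rel (pr .sub) ![.var x, .var y]

/-- `∃u ∀y ↔ ∈y,u & ∈y,x F`. -/
def separation (x y u : ℕ) (F : Form (Sig L₀)) : Form (Sig L₀) :=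
  ex u (all y (iff (mem y u) (and (mem y x) F)))

/-- `→ ∀y ↔ ∈y,u ∈y,v ∼u,v`. -/
def extensionality (u v y : ℕ) : Form (Sig L₀) :=
  imp (all y (iff (mem y u) (mem y v))) (eqv u v)

/-- Regularity: a nonempty `u` has a member `y` with no member in common with `u`. -/
def regularity (u y z : ℕ) : Form (Sig L₀) :=
  imp (ex y (mem y u)) (ex y (and (mem y u) (neg (ex z (and (mem z u) (mem z y))))))

/-- `∃u & ∈x,u ∈y,u`. -/
def pairing (x y u : ℕ) : Form (Sig L₀) := ex u (and (mem x u) (mem y u))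

/-- Every `x` is a member of a subset-friendly set `u`. -/
def subsetFriendly (t u v w x y z : ℕ) : Form (Sig L₀) :=
  ex u (and (and (and
    (mem x u)
    (all y (imp (mem y u) (all z (imp (mem z y) (mem z u))))))
    (all y (imp (mem y u) (ex z (and (mem z u)
      (all v (iff (mem v z) (all w (imp (mem w v) (mem w y))))))))))
    (all y (imp (mem y u) (all z (imp (mem z u)
      (ex v (and (and (mem v u) (and (mem y v) (mem z v)))
        (all w (imp (mem w v) (all t (imp (mem t w) (mem t v))))))))))))

/-- Choice: a set `u` of nonempty pairwise disjoint sets `x` has a set `y` meeting each of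
them in exactly one point `v`. -/
def choice (u v w x y : ℕ) : Form (Sig L₀) :=
  imp (all x (imp (mem x u) (ex w (mem w x))))
    (imp (all x (all y (imp (mem x u) (imp (mem y u)
        (imp (ex w (and (mem w x) (mem w y))) (eqv x y))))))
      (ex y (all x (imp (mem x u)
        (ex v (and (and (mem v x) (mem v y))
          (all w (imp (and (mem w x) (mem w y)) (eqv v w)))))))))

/-- The predicate symbol `∈`, as the only element of a set of predicate symbols. -/
def memSym : Set (Σ n, (Sig L₀).Relations n) := {⟨2, pr .mem⟩}

/-- The basis axioms of RST. -/
inductive BasisRST : Form (Sig L₀) → Prop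
  | ext (u v y : ℕ) : [u, v, y].Nodup → BasisRST (extensionality u v y)
  | sep (x y u : ℕ) (F : Form (Sig L₀)) : [x, y, u].Nodup → F.Over ∅ memSym →
      u ∉ F.var → x ∉ F.var → BasisRST (separation x y u F)
  | reg (u y z : ℕ) : [u, y, z].Nodup → BasisRST (regularity u y z)
  | pair (x y u : ℕ) : [x, y, u].Nodup → BasisRST (pairing x y u)
  | sf (t u v w x y z : ℕ) : [t, u, v, w, x, y, z].Nodup →
      BasisRST (subsetFriendly t u v w x y z)
  | ac (u v w x y : ℕ) : [u, v, w, x, y].Nodup → BasisRST (choice u v w x y)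

/-- The defining axioms of `∅`, `⊆`, `∪`, `σ`, `σ₂`, `𝒫`. -/
inductive BasisDef : Form (Sig L₀) → Prop
  | empty (u y : ℕ) : [u, y].Nodup → BasisDef
      (iff (eq (.var u) (.func (fn .empty) ![])) (all y (neg (mem y u))))
  | subset (u v y : ℕ) : [u, v, y].Nodup → BasisDef
      (iff (sub u v) (all y (imp (mem y u) (mem y v))))
  | union (u x y z : ℕ) : [u, x, y, z].Nodup → BasisDef
      (iff (eq (.var u) (.func (fn .union) ![.var x]))
        (all z (iff (mem z u) (ex y (and (mem z y) (mem y x))))))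
  | sing (u x y : ℕ) : [u, x, y].Nodup → BasisDef
      (iff (eq (.var u) (.func (fn .sing) ![.var x]))
        (all y (iff (mem y u) (eqv y x))))
  | pair (u x y z : ℕ) : [u, x, y, z].Nodup → BasisDef
      (iff (eq (.var u) (.func (fn .pair) ![.var x, .var y]))
        (all z (iff (mem z u) (or (eqv z x) (eqv z y)))))
  | pow (v w x z : ℕ) : [v, w, x, z].Nodup → BasisDef
      (iff (eq (.var z) (.func (fn .pow) ![.var x]))
        (all v (iff (mem v z) (all w (imp (mem w v) (mem w x))))))

theorem TermOver.mono {A A' : Set (Σ n, (Sig L₀).Functions n)} (h : A ⊆ A') :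
    ∀ t : (Sig L₀).Term ℕ, TermOver A t → TermOver A' t
  | .var _, _ => trivial
  | .func _ ts, ht => ⟨h ht.1, fun i => TermOver.mono h (ts i) (ht.2 i)⟩

theorem Form.Over.mono {A A' : Set (Σ n, (Sig L₀).Functions n)}
    {P P' : Set (Σ n, (Sig L₀).Relations n)} (hA : A ⊆ A') (hP : P ⊆ P')
    {F : Form (Sig L₀)} (hF : F.Over A P) : F.Over A' P' := by
  induction F with
  | eq s t => exact ⟨TermOver.mono hA _ hF.1, TermOver.mono hA _ hF.2⟩
  | rel p ts => exact ⟨hP hF.1, fun i => TermOver.mono hA _ (hF.2 i)⟩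
  | neg F ih => exact ih hF
  | imp F G ih₁ ih₂ => exact ⟨ih₁ hF.1, ih₂ hF.2⟩
  | and F G ih₁ ih₂ => exact ⟨ih₁ hF.1, ih₂ hF.2⟩
  | or F G ih₁ ih₂ => exact ⟨ih₁ hF.1, ih₂ hF.2⟩
  | iff F G ih₁ ih₂ => exact ⟨ih₁ hF.1, ih₂ hF.2⟩
  | all x F ih => exact ih hF
  | ex x F ih => exact ih hF

theorem BasisRST.isOver {F : Form (Sig L₀)} (h : BasisRST F) : F.Over ∅ memSym := by
  cases h <;>
    simp_all [extensionality, separation, regularity, pairing, subsetFriendly, choice, mem, eqv,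
      Form.Over, TermOver, memSym, Fin.forall_fin_two]

theorem BasisDef.isOver {F : Form (Sig L₀)} (h : BasisDef F) :
    F.Over {⟨0, fn .empty⟩, ⟨1, fn .union⟩, ⟨1, fn .sing⟩, ⟨2, fn .pair⟩, ⟨1, fn .pow⟩}
      {⟨2, pr .mem⟩, ⟨2, pr .sub⟩} := by
  cases h <;> simp [mem, sub, eqv, Form.Over, TermOver, Fin.forall_fin_two]

/-- The formal system RST of reduced set theory. -/
def systemRST (L₀ : FirstOrder.Language.{u, v}) : System (Sig L₀) where
  A := ∅
  P := memSym
  B := {F | BasisRST F}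
  basis_over _ h := h.isOver

/-- The system RST_ext. -/
def systemRSText (L₀ : FirstOrder.Language.{u, v}) : System (Sig L₀) where
  A := {⟨0, fn .empty⟩, ⟨1, fn .union⟩, ⟨1, fn .sing⟩, ⟨2, fn .pair⟩, ⟨1, fn .pow⟩}
  P := {⟨2, pr .mem⟩, ⟨2, pr .sub⟩}
  B := {F | BasisRST F ∨ BasisDef F}
  basis_over _ h := h.elim
    (fun h => h.isOver.mono (Set.empty_subset _) (by simp [memSym]))
    (fun h => h.isOver)

/-- Subset-friendly theories: extensions of RST in which the subset axioms are provable for all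
formulas of the extension. -/
def IsSubsetFriendly (M : System (Sig L₀)) : Prop :=
  (systemRST L₀).IsExtension M ∧
    ∀ (x y u : ℕ) (F : Form (Sig L₀)), [x, y, u].Nodup → F ∈ M.formulas →
      u ∉ F.var → x ∉ F.var → separation x y u F ∈ M.provables

/-- Existence of the empty set: `∃u ∀y ¬ ∈y,u`. -/
def emptySetExists (u y : ℕ) : Form (Sig L₀) := ex u (all y (neg (mem y u)))

/-- Existence of unions: `∃u ∀z ↔ ∈z,u ∃y & ∈z,y ∈y,x`. -/
def unionExists (x y z u : ℕ) : Form (Sig L₀) :=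
  ex u (all z (iff (mem z u) (ex y (and (mem z y) (mem y x)))))

/-- Existence of pair sets: `∃u ∀z ↔ ∈z,u ∨ ∼z,x ∼z,y`. -/
def pairSetExists (x y z u : ℕ) : Form (Sig L₀) :=
  ex u (all z (iff (mem z u) (or (eqv z x) (eqv z y))))

/-- Existence of power sets: `∃z ∀v ↔ ∈v,z ∀w → ∈w,v ∈w,x`. -/
def powerSetExists (x z v w : ℕ) : Form (Sig L₀) :=
  ex z (all v (iff (mem v z) (all w (imp (mem w v) (mem w x)))))

/-- Existence of an inductive set: a set `x` which contains an empty set `y`, and with each `y`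
also a set `z` whose members are the members of `y` and `y` itself. -/
def inductiveSetExists (x y z v : ℕ) : Form (Sig L₀) :=
  ex x (and (ex y (and (mem y x) (all z (neg (mem z y)))))
    (all y (imp (mem y x) (ex z (and (mem z x)
      (all v (iff (mem v z) (or (mem v y) (eqv v y)))))))))

/-- The ZFC axioms for sets without replacement. The formula in a subset axiom is any formula in
the single predicate symbol `∈` in which `u` is not free. -/
inductive ZFCWithoutReplacement : Form (Sig L₀) → Prop
  | ext (u v y : ℕ) : [u, v, y].Nodup → ZFCWithoutReplacement (extensionality u v y)
  | sep (x y u : ℕ) (F : Form (Sig L₀)) : [x, y, u].Nodup → F.Over ∅ memSym →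
      u ∉ F.free → ZFCWithoutReplacement (separation x y u F)
  | reg (u y z : ℕ) : [u, y, z].Nodup → ZFCWithoutReplacement (regularity u y z)
  | empty (u y : ℕ) : [u, y].Nodup → ZFCWithoutReplacement (emptySetExists u y)
  | union (x y z u : ℕ) : [x, y, z, u].Nodup → ZFCWithoutReplacement (unionExists x y z u)
  | pair (x y z u : ℕ) : [x, y, z, u].Nodup → ZFCWithoutReplacement (pairSetExists x y z u)
  | pow (x z v w : ℕ) : [x, z, v, w].Nodup → ZFCWithoutReplacement (powerSetExists x z v w)
  | inf (x y z v : ℕ) : [x, y, z, v].Nodup → ZFCWithoutReplacement (inductiveSetExists x y z v)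
  | ac (u v w x y : ℕ) : [u, v, w, x, y].Nodup → ZFCWithoutReplacement (choice u v w x y)

end SetTheory

end SetTh

/-!
The proof is semantic. For a system with countably many symbols, the Hilbert calculus is sound
(`System.Provable.sound`) and complete (`System.provable_of_sat`), so that provability in RST and
in RST_ext may be replaced by truth in all models. The statements about an arbitrary
subset-friendly theory reduce to RST, because such a theory proves everything RST proves; hence
completeness is not needed for systems with uncountably many symbols.

Completeness is shown by a Henkin construction without new constants: since the alphabet has
infinitely many variables and the formulas can be enumerated, an unprovable formula is kept out of
a maximal consistent set in which each accepted `∃xF` has a variable as a witness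
(`System.exists_isHenkin`). The model consists of the variables modulo the equations in the set, and truth
in it is membership in the set (`System.IsHenkin.sat_iff_mem`). The work in the calculus is confined
to renaming bound variables (`System.exists_provable_iff_bound_disjoint`) and to instantiating the
equality axioms by terms (`System.Provable.msubst`).

In a model of RST, every set `a` lies in a transitive set `u` which is closed under power sets and
any two members of which lie in a transitive member of `u`. Unions and pair sets are separated from
such sets, the power set of `a` is a member of `u`, and if `a` is empty, then `u` is inductive,
because `y ∪ {y}` belongs to the power set of a transitive `v ∈ u` with `y ∈ v`
(`exists_inductive`). Separation holds in a model for every property definable by a formula of RST,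
as one may choose the variables of the subset axiom away from the formula (`sat_separation`).

For RST_ext, the defining axioms make every formula equivalent, in each model, to a formula of RST
(`definable_sat`), and so RST_ext is subset-friendly. It is conservative because every model of
RST expands to a model of RST_ext (`exists_models_rstext`).
-/

namespace SetTh

open FirstOrder.Language (Term)

section Semantics

/-! ### Variables and substitution -/

variable {L : FirstOrder.Language.{u, v}}

theorem finite_termVar : ∀ t : L.Term ℕ, (termVar t).Finite
  | .var x => Set.finite_singleton x
  | .func _ ts => Set.finite_iUnion fun i => finite_termVar (ts i)

theorem Form.finite_var (F : Form L) : F.var.Finite := by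
  induction F with
  | eq s t => exact (finite_termVar s).union (finite_termVar t)
  | rel p ts => exact Set.finite_iUnion fun i => finite_termVar (ts i)
  | neg F ih => exact ih
  | imp F G ih₁ ih₂ | and F G ih₁ ih₂ | or F G ih₁ ih₂ | iff F G ih₁ ih₂ => exact ih₁.union ih₂
  | all x F ih | ex x F ih => exact ih.insert x

theorem Form.free_subset_var (F : Form L) : F.free ⊆ F.var := by
  induction F with
  | eq s t => exact subset_rfl
  | rel p ts => exact subset_rfl
  | neg F ih => exact ih
  | imp F G ih₁ ih₂ | and F G ih₁ ih₂ | or F G ih₁ ih₂ | iff F G ih₁ ih₂ =>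
    exact Set.union_subset_union ih₁ ih₂
  | all x F ih | ex x F ih => exact fun y hy => Or.inr (ih hy.1)

/-- A term substitution only depends on its values at the variables of the term. -/
theorem term_subst_congr {σ σ' : ℕ → L.Term ℕ} :
    ∀ t : L.Term ℕ, (∀ x ∈ termVar t, σ x = σ' x) → t.subst σ = t.subst σ'
  | .var x, h => h x rfl
  | .func f ts, h => by
    simp only [Term.subst]
    congr 1
    funext i
    exact term_subst_congr (ts i) fun x hx => h x (Set.mem_iUnion_of_mem i hx)

theorem term_subst_var : ∀ t : L.Term ℕ, t.subst Term.var = t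
  | .var x => rfl
  | .func f ts => by
    simp only [Term.subst]
    congr 1
    funext i
    exact term_subst_var (ts i)

theorem term_subst_subst (σ σ' : ℕ → L.Term ℕ) :
    ∀ t : L.Term ℕ, (t.subst σ).subst σ' = t.subst fun x => (σ x).subst σ'
  | .var x => rfl
  | .func f ts => by
    simp only [Term.subst]
    congr 1
    funext i
    exact term_subst_subst σ σ' (ts i)

theorem termSubst_of_notMem {t : L.Term ℕ} {x : ℕ} (s : L.Term ℕ) (h : x ∉ termVar t) :
    termSubst t x s = t := by
  rw [termSubst, term_subst_congr (σ' := Term.var) t, term_subst_var]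
  intro y hy
  rw [Function.update_of_ne]
  rintro rfl
  exact h hy

theorem termVar_subst (σ : ℕ → L.Term ℕ) :
    ∀ t : L.Term ℕ, termVar (t.subst σ) = ⋃ x ∈ termVar t, termVar (σ x)
  | .var x => by simp [Term.subst, termVar]
  | .func f ts => by
    simp only [Term.subst, termVar, Set.biUnion_iUnion]
    exact Set.iUnion_congr fun i => termVar_subst σ (ts i)

theorem TermOver.subst {A : Set (Σ n, L.Functions n)} {σ : ℕ → L.Term ℕ}
    (hσ : ∀ x, TermOver A (σ x)) : ∀ {t : L.Term ℕ}, TermOver A t → TermOver A (t.subst σ)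
  | .var x, _ => hσ x
  | .func _ _, h => ⟨h.1, fun i => TermOver.subst hσ (h.2 i)⟩

theorem TermOver.update {A : Set (Σ n, L.Functions n)} {σ : ℕ → L.Term ℕ}
    (hσ : ∀ x, TermOver A (σ x)) (a : ℕ) {s : L.Term ℕ} (hs : TermOver A s) (x : ℕ) :
    TermOver A (Function.update σ a s x) := by
  by_cases h : x = a
  · subst h; simpa using hs
  · simpa [h] using hσ x

theorem TermOver.termSubst {A : Set (Σ n, L.Functions n)} {t s : L.Term ℕ} (ht : TermOver A t)
    (x : ℕ) (hs : TermOver A s) : TermOver A (termSubst t x s) :=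
  TermOver.subst (TermOver.update (σ := Term.var) (fun _ => by simp [TermOver]) x hs) ht

theorem Form.Over.subst {A : Set (Σ n, L.Functions n)} {P : Set (Σ n, L.Relations n)}
    {F : Form L} (hF : F.Over A P) (x : ℕ) {s : L.Term ℕ} (hs : TermOver A s) :
    (F.subst x s).Over A P := by
  induction F with
  | eq t₁ t₂ => exact ⟨hF.1.termSubst x hs, hF.2.termSubst x hs⟩
  | rel p ts => exact ⟨hF.1, fun i => (hF.2 i).termSubst x hs⟩
  | neg F ih => exact ih hF
  | imp F G ih₁ ih₂ | and F G ih₁ ih₂ | or F G ih₁ ih₂ | iff F G ih₁ ih₂ =>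
    exact ⟨ih₁ hF.1, ih₂ hF.2⟩
  | all y F ih | ex y F ih =>
    rw [Form.subst]
    split_ifs
    · exact hF
    · exact ih hF

theorem Form.subst_of_notMem_free {F : Form L} {x : ℕ} (s : L.Term ℕ) (h : x ∉ F.free) :
    F.subst x s = F := by
  induction F with
  | eq t₁ t₂ =>
    simp only [free, Set.mem_union, not_or] at h
    simp [Form.subst, termSubst_of_notMem s h.1, termSubst_of_notMem s h.2]
  | rel p ts =>
    simp only [free, Set.mem_iUnion, not_exists] at h
    simp [Form.subst, termSubst_of_notMem s (h _)]
  | neg F ih => simp [Form.subst, ih h]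
  | imp F G ih₁ ih₂ | and F G ih₁ ih₂ | or F G ih₁ ih₂ | iff F G ih₁ ih₂ =>
    simp only [free, Set.mem_union, not_or] at h
    simp [Form.subst, ih₁ h.1, ih₂ h.2]
  | all y F ih | ex y F ih =>
    rw [Form.subst]
    split_ifs with hy
    · rfl
    · rw [ih fun hx => h ⟨hx, fun e => hy e.symm⟩]

/-! ### Semantics and soundness -/

variable {D : Type*} [L.Structure D]

theorem realize_congr {ρ ρ' : ℕ → D} :
    ∀ t : L.Term ℕ, (∀ x ∈ termVar t, ρ x = ρ' x) → t.realize ρ = t.realize ρ'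
  | .var x, h => h x rfl
  | .func f ts, h => by
    simp only [Term.realize]
    congr 1
    funext i
    exact realize_congr (ts i) fun x hx => h x (Set.mem_iUnion_of_mem i hx)

theorem realize_termSubst (ρ : ℕ → D) (t : L.Term ℕ) (x : ℕ) (s : L.Term ℕ) :
    (termSubst t x s).realize ρ = t.realize (Function.update ρ x (s.realize ρ)) := by
  rw [termSubst, Term.realize_subst]
  congr 1
  funext y
  by_cases h : y = x
  · subst h; simp
  · simp [h]

/-- Tarski's truth: the formula holds in the structure `D` when its free variables take the values
given by the assignment. -/
def Form.Sat : (ℕ → D) → Form L → Prop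
  | ρ, eq s t => s.realize ρ = t.realize ρ
  | ρ, rel p ts => FirstOrder.Language.Structure.RelMap p fun i => (ts i).realize ρ
  | ρ, neg F => ¬ F.Sat ρ
  | ρ, imp F G => F.Sat ρ → G.Sat ρ
  | ρ, and F G => F.Sat ρ ∧ G.Sat ρ
  | ρ, or F G => F.Sat ρ ∨ G.Sat ρ
  | ρ, iff F G => F.Sat ρ ↔ G.Sat ρ
  | ρ, all x F => ∀ d, F.Sat (Function.update ρ x d)
  | ρ, ex x F => ∃ d, F.Sat (Function.update ρ x d)

theorem Form.sat_congr {F : Form L} {ρ ρ' : ℕ → D} (h : ∀ x ∈ F.free, ρ x = ρ' x) :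
    F.Sat ρ ↔ F.Sat ρ' := by
  induction F generalizing ρ ρ' with
  | eq s t =>
    simp only [Sat, realize_congr s fun x hx => h x (Or.inl hx),
      realize_congr t fun x hx => h x (Or.inr hx)]
  | rel p ts =>
    simp only [Sat, fun i => realize_congr (ts i) fun x hx => h x (Set.mem_iUnion_of_mem i hx)]
  | neg F ih => simp only [Sat, ih h]
  | imp F G ih₁ ih₂ | and F G ih₁ ih₂ | or F G ih₁ ih₂ | iff F G ih₁ ih₂ =>
    simp only [Sat, ih₁ fun x hx => h x (Or.inl hx), ih₂ fun x hx => h x (Or.inr hx)]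
  | all y F ih =>
    refine forall_congr' fun d => ih fun x hx => ?_
    by_cases hxy : x = y
    · subst hxy; simp
    · simpa [hxy] using h x ⟨hx, hxy⟩
  | ex y F ih =>
    refine exists_congr fun d => ih fun x hx => ?_
    by_cases hxy : x = y
    · subst hxy; simp
    · simpa [hxy] using h x ⟨hx, hxy⟩

theorem Form.sat_update_of_notMem_free {F : Form L} {x : ℕ} (h : x ∉ F.free) (ρ : ℕ → D) (d : D) :
    F.Sat (Function.update ρ x d) ↔ F.Sat ρ :=
  sat_congr fun y hy => Function.update_of_ne (by rintro rfl; exact h hy) _ _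

theorem Form.sat_subst {F : Form L} {x : ℕ} {s : L.Term ℕ} (h : F.CollisionFree x s) (ρ : ℕ → D) :
    (F.subst x s).Sat ρ ↔ F.Sat (Function.update ρ x (s.realize ρ)) := by
  induction F generalizing ρ with
  | eq t₁ t₂ => simp only [Form.subst, Sat, realize_termSubst]
  | rel p ts => simp only [Form.subst, Sat, realize_termSubst]
  | neg F ih => simp only [Form.subst, Sat, ih h]
  | imp F G ih₁ ih₂ | and F G ih₁ ih₂ | or F G ih₁ ih₂ | iff F G ih₁ ih₂ =>
    simp only [Form.subst, Sat, ih₁ h.1, ih₂ h.2]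
  | all y F ih | ex y F ih =>
    rcases h with h | ⟨hy, hF⟩
    · rw [Form.subst_of_notMem_free s h, Form.sat_update_of_notMem_free h]
    · rw [Form.subst]
      split_ifs with hyx
      · rw [Form.sat_update_of_notMem_free]
        simp [free, hyx]
      · simp only [Sat, ih hF]
        have key (d : D) : Function.update (Function.update ρ y d) x
            (s.realize (Function.update ρ y d)) =
            Function.update (Function.update ρ x (s.realize ρ)) y d := by
          rw [Function.update_comm hyx, realize_congr s (ρ' := ρ)]
          intro z hz
          rw [Function.update_of_ne]
          rintro rfl
          exact hy hz
        simp only [key]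

theorem Form.sat_foldr_imp (Γ : List (Form L)) (F : Form L) (ρ : ℕ → D) :
    (Γ.foldr imp F).Sat ρ ↔ ((∀ G ∈ Γ, G.Sat ρ) → F.Sat ρ) := by
  induction Γ with
  | nil => simp
  | cons G Γ ih => simp [Sat, ih]

theorem Form.propTruth_sat (F : Form L) (ρ : ℕ → D) :
    F.propTruth (fun G => G.Sat ρ) ↔ F.Sat ρ := by
  induction F with
  | neg F ih => simp only [propTruth, Sat, ih]
  | imp F G ih₁ ih₂ | and F G ih₁ ih₂ | or F G ih₁ ih₂ | iff F G ih₁ ih₂ =>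
    simp only [propTruth, Sat, ih₁, ih₂]
  | _ => rfl

/-- The structure is a model of the system: the basis axioms hold under all assignments. -/
def System.Models (M : System L) (D : Type*) [L.Structure D] : Prop :=
  ∀ F ∈ M.B, ∀ ρ : ℕ → D, F.Sat ρ

theorem System.Provable.sound {M : System L} (hM : M.Models D) {F : Form L} (h : M.Provable F)
    (ρ : ℕ → D) : F.Sat ρ := by
  induction h generalizing ρ with
  | basis h => exact hM _ h ρ
  | taut _ h => exact (Form.propTruth_sat _ ρ).1 (h _)
  | eqRefl x => rfl
  | eqEq x x₁ y y₁ =>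
    intro h₁ h₂ h₃
    exact h₁.symm.trans (h₃.trans h₂)
  | eqFun f xs ys _ =>
    rw [Form.impChain, Form.sat_foldr_imp]
    intro h
    simp only [List.forall_mem_ofFn_iff, Form.eqv, Form.Sat, Term.realize_var] at h
    simp [Form.Sat, h]
  | eqRel p xs ys _ =>
    rw [Form.impChain, Form.sat_foldr_imp]
    intro h
    simp only [List.forall_mem_ofFn_iff, Form.eqv, Form.Sat, Term.realize_var] at h
    simp [Form.Sat, h]
  | allElim x _ =>
    intro h
    simpa using h (ρ x)
  | allImp x _ _ hx =>
    intro h hF d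
    exact h d ((Form.sat_update_of_notMem_free hx ρ d).2 hF)
  | exIff x _ => simp [Form.Sat]
  | mp _ _ ih₁ ih₂ => exact ih₂ ρ (ih₁ ρ)
  | subst x s _ _ hc ih => exact (Form.sat_subst hc ρ).2 (ih _)
  | gen x _ ih => exact fun d => ih _

end Semantics

end SetTh

namespace SetTh

open FirstOrder.Language (Term)

section Calculus

/-! ### Derived rules of the calculus -/

variable {L : FirstOrder.Language.{u, v}}

theorem Form.over_foldr_imp {A : Set (Σ n, L.Functions n)} {P : Set (Σ n, L.Relations n)}
    {Γ : List (Form L)} {F : Form L} (hΓ : ∀ G ∈ Γ, G.Over A P) (hF : F.Over A P) :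
    (Γ.foldr imp F).Over A P := by
  induction Γ with
  | nil => exact hF
  | cons G Γ ih =>
    simp only [List.forall_mem_cons] at hΓ
    exact ⟨hΓ.1, ih hΓ.2⟩

theorem Form.propTruth_foldr_imp (Γ : List (Form L)) (F : Form L) (τ : Form L → Prop) :
    (Γ.foldr imp F).propTruth τ ↔ ((∀ G ∈ Γ, G.propTruth τ) → F.propTruth τ) := by
  induction Γ with
  | nil => simp
  | cons G Γ ih => simp [propTruth, ih]

namespace System

variable {M : System L}

theorem var_mem_terms (M : System L) (x : ℕ) : Term.var x ∈ M.terms := trivial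

theorem Provable.mem_formulas {F : Form L} (h : M.Provable F) : F ∈ M.formulas := by
  induction h with
  | basis h => exact M.basis_over _ h
  | taut h _ => exact h
  | eqRefl x => exact ⟨trivial, trivial⟩
  | eqEq => simp [formulas, Form.eqv, Form.Over, TermOver]
  | eqFun f xs ys hf =>
    refine Form.over_foldr_imp ?_ ⟨⟨hf, fun i => trivial⟩, hf, fun i => trivial⟩
    simp [Form.eqv, Form.Over, TermOver]
  | eqRel p xs ys hp =>
    refine Form.over_foldr_imp ?_ ⟨⟨hp, fun i => trivial⟩, hp, fun i => trivial⟩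
    simp [Form.eqv, Form.Over, TermOver]
  | allElim x h => exact ⟨h, h⟩
  | allImp x h₁ h₂ _ => exact ⟨⟨h₁, h₂⟩, h₁, h₂⟩
  | exIff x h => exact ⟨h, h⟩
  | mp _ _ _ ih => exact ih.2
  | subst x s _ hs _ ih => exact Form.Over.subst ih x hs
  | gen x _ ih => exact ih

/-- Every tautological consequence of provable formulas is provable. -/
theorem Provable.of_taut (Γ : List (Form L)) {F : Form L} (hΓ : ∀ G ∈ Γ, M.Provable G)
    (hF : F ∈ M.formulas) (h : ∀ τ, (∀ G ∈ Γ, G.propTruth τ) → F.propTruth τ) :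
    M.Provable F := by
  have key : M.Provable (Γ.foldr Form.imp F) :=
    .taut (Form.over_foldr_imp (fun G hG => (hΓ G hG).mem_formulas) hF)
      fun τ => (Form.propTruth_foldr_imp Γ F τ).2 (h τ)
  clear h
  induction Γ with
  | nil => exact key
  | cons G Γ ih =>
    simp only [List.forall_mem_cons] at hΓ
    exact ih hΓ.2 (.mp hΓ.1 key)

theorem Provable.of_taut₁ {G F : Form L} (hG : M.Provable G) (hF : F ∈ M.formulas)
    (h : ∀ τ, G.propTruth τ → F.propTruth τ) : M.Provable F :=
  .of_taut [G] (by simpa using hG) hF (by simpa using h)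

theorem Provable.of_taut₂ {G₁ G₂ F : Form L} (h₁ : M.Provable G₁) (h₂ : M.Provable G₂)
    (hF : F ∈ M.formulas) (h : ∀ τ, G₁.propTruth τ → G₂.propTruth τ → F.propTruth τ) :
    M.Provable F :=
  .of_taut [G₁, G₂] (by simpa using ⟨h₁, h₂⟩) hF (by simpa using h)

theorem Provable.imp_all {F G : Form L} {x : ℕ} (h : M.Provable (.imp F G)) (hx : x ∉ F.free) :
    M.Provable (.imp F (.all x G)) :=
  .mp (.gen x h) (.allImp x h.mem_formulas.1 h.mem_formulas.2 hx)

theorem Provable.all_imp_all {F G : Form L} (x : ℕ) (h : M.Provable (.imp F G)) :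
    M.Provable (.imp (.all x F) (.all x G)) := by
  refine imp_all (.of_taut₂ h (.allElim x h.mem_formulas.1)
    ⟨h.mem_formulas.1, h.mem_formulas.2⟩ ?_) (by simp [Form.free])
  simp only [Form.propTruth]
  tauto

theorem Provable.imp_of_iff {F G : Form L} (h : M.Provable (.iff F G)) :
    M.Provable (.imp F G) :=
  .of_taut₁ h h.mem_formulas
    (by simp only [Form.propTruth]; tauto)

theorem Provable.iff_symm {F G : Form L} (h : M.Provable (.iff F G)) :
    M.Provable (.iff G F) :=
  .of_taut₁ h ⟨h.mem_formulas.2, h.mem_formulas.1⟩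
    (by simp only [Form.propTruth]; tauto)

theorem Provable.iff_trans {F G H : Form L} (h : M.Provable (.iff F G))
    (h' : M.Provable (.iff G H)) : M.Provable (.iff F H) :=
  .of_taut₂ h h' ⟨h.mem_formulas.1, h'.mem_formulas.2⟩
    (by simp only [Form.propTruth]; tauto)

theorem Provable.iff_intro {F G : Form L} (h : M.Provable (.imp F G))
    (h' : M.Provable (.imp G F)) : M.Provable (.iff F G) :=
  .of_taut₂ h h' h.mem_formulas
    (by simp only [Form.propTruth]; tauto)

theorem Provable.neg_congr {F G : Form L} (h : M.Provable (.iff F G)) :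
    M.Provable (.iff (.neg F) (.neg G)) :=
  .of_taut₁ h h.mem_formulas
    (by simp only [Form.propTruth]; tauto)

theorem Provable.all_congr {F G : Form L} (x : ℕ) (h : M.Provable (.iff F G)) :
    M.Provable (.iff (.all x F) (.all x G)) :=
  .iff_intro (.all_imp_all x h.imp_of_iff) (.all_imp_all x h.iff_symm.imp_of_iff)

theorem Provable.ex_congr {F G : Form L} (x : ℕ) (h : M.Provable (.iff F G)) :
    M.Provable (.iff (.ex x F) (.ex x G)) :=
  (Provable.exIff x h.mem_formulas.1).iff_trans
    ((h.neg_congr.all_congr x).neg_congr.iff_trans (Provable.exIff x h.mem_formulas.2).iff_symm)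

/-- The axiom `∀x F → F` with a term substituted for `x`. -/
theorem Provable.all_imp_subst {F : Form L} (hF : F ∈ M.formulas) (x : ℕ) {s : L.Term ℕ}
    (hs : s ∈ M.terms) (hc : F.CollisionFree x s) : M.Provable (.imp (.all x F) (F.subst x s)) := by
  have h := Provable.subst x s (.allElim x hF) hs ⟨Or.inl (by simp [Form.free]), hc⟩
  simpa [Form.subst] using h

theorem Provable.subst_imp_ex {F : Form L} (hF : F ∈ M.formulas) (x : ℕ) {s : L.Term ℕ}
    (hs : s ∈ M.terms) (hc : F.CollisionFree x s) : M.Provable (.imp (F.subst x s) (.ex x F)) := by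
  refine .of_taut₂ (.all_imp_subst (F := .neg F) hF x hs hc) (.exIff x hF) ⟨hF.subst x hs, hF⟩ ?_
  simp only [Form.propTruth, Form.subst]
  tauto

end System

/-! ### Renaming of bound variables -/

namespace Form

/-- The variables bound by a quantifier of the formula. -/
def bound : Form L → Set ℕ
  | eq _ _ => ∅
  | rel _ _ => ∅
  | neg F => F.bound
  | imp F G => F.bound ∪ G.bound
  | and F G => F.bound ∪ G.bound
  | or F G => F.bound ∪ G.bound
  | iff F G => F.bound ∪ G.bound
  | all x F => insert x F.bound
  | ex x F => insert x F.bound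

/-- The nesting depth of connectives and quantifiers. A universal quantifier counts twice, so that
`∀xF` is deeper than `¬F`, the formula whose instances have to be considered for `¬∃x¬F`. -/
def depth : Form L → ℕ
  | eq _ _ => 0
  | rel _ _ => 0
  | neg F => F.depth + 1
  | imp F G => max F.depth G.depth + 1
  | and F G => max F.depth G.depth + 1
  | or F G => max F.depth G.depth + 1
  | iff F G => max F.depth G.depth + 1
  | all _ F => F.depth + 2
  | ex _ F => F.depth + 1

theorem bound_subset_var (F : Form L) : F.bound ⊆ F.var := by
  induction F with
  | eq s t => exact Set.empty_subset _
  | rel p ts => exact Set.empty_subset _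
  | neg F ih => exact ih
  | imp F G ih₁ ih₂ | and F G ih₁ ih₂ | or F G ih₁ ih₂ | iff F G ih₁ ih₂ =>
    exact Set.union_subset_union ih₁ ih₂
  | all x F ih | ex x F ih => exact Set.insert_subset_insert ih

theorem depth_subst (F : Form L) (x : ℕ) (s : L.Term ℕ) : (F.subst x s).depth = F.depth := by
  induction F with
  | eq s t => rfl
  | rel p ts => rfl
  | neg F ih => simp [subst, depth, ih]
  | imp F G ih₁ ih₂ | and F G ih₁ ih₂ | or F G ih₁ ih₂ | iff F G ih₁ ih₂ =>
    simp [subst, depth, ih₁, ih₂]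
  | all x F ih | ex x F ih =>
    rw [subst]
    split_ifs <;> simp [depth, ih]

theorem bound_subst (F : Form L) (x : ℕ) (s : L.Term ℕ) : (F.subst x s).bound = F.bound := by
  induction F with
  | eq s t => rfl
  | rel p ts => rfl
  | neg F ih => simp [subst, bound, ih]
  | imp F G ih₁ ih₂ | and F G ih₁ ih₂ | or F G ih₁ ih₂ | iff F G ih₁ ih₂ =>
    simp [subst, bound, ih₁, ih₂]
  | all x F ih | ex x F ih =>
    rw [subst]
    split_ifs <;> simp [bound, ih]

theorem collisionFree_of_disjoint {F : Form L} (x : ℕ) {s : L.Term ℕ}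
    (h : Disjoint (termVar s) F.bound) : F.CollisionFree x s := by
  induction F with
  | eq s t => trivial
  | rel p ts => trivial
  | neg F ih => exact ih h
  | imp F G ih₁ ih₂ | and F G ih₁ ih₂ | or F G ih₁ ih₂ | iff F G ih₁ ih₂ =>
    rw [bound, Set.disjoint_union_right] at h
    exact ⟨ih₁ h.1, ih₂ h.2⟩
  | all y F ih | ex y F ih =>
    rw [bound, Set.disjoint_insert_right] at h
    exact Or.inr ⟨h.1, ih h.2⟩

theorem collisionFree_var {F : Form L} (x : ℕ) {y : ℕ} (h : y ∉ F.bound) :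
    F.CollisionFree x (.var y) :=
  collisionFree_of_disjoint x (by simpa [termVar] using h)

theorem termVar_termSubst_var {t : L.Term ℕ} {x y : ℕ} :
    termVar (termSubst t x (.var y)) ⊆ insert y (termVar t \ {x}) := by
  rw [termSubst, termVar_subst]
  intro z hz
  simp only [Set.mem_iUnion] at hz
  obtain ⟨w, hw, hz⟩ := hz
  by_cases h : w = x
  · subst h
    left
    simpa [termVar] using hz
  · rw [Function.update_of_ne h] at hz
    obtain rfl : z = w := hz
    exact Or.inr ⟨hw, h⟩

theorem free_subst_var (F : Form L) (x y : ℕ) :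
    (F.subst x (.var y)).free ⊆ insert y (F.free \ {x}) := by
  induction F with
  | eq s t =>
    refine Set.union_subset (termVar_termSubst_var.trans ?_) (termVar_termSubst_var.trans ?_) <;>
    · refine Set.insert_subset_insert (Set.sdiff_subset_sdiff_left ?_)
      simp [free]
  | rel p ts =>
    exact Set.iUnion_subset fun i => termVar_termSubst_var.trans
      (Set.insert_subset_insert (Set.sdiff_subset_sdiff_left
        (Set.subset_iUnion (fun i => termVar (ts i)) i)))
  | neg F ih => exact ih
  | imp F G ih₁ ih₂ | and F G ih₁ ih₂ | or F G ih₁ ih₂ | iff F G ih₁ ih₂ =>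
    refine Set.union_subset (ih₁.trans ?_) (ih₂.trans ?_) <;>
    · refine Set.insert_subset_insert (Set.sdiff_subset_sdiff_left ?_)
      simp [free]
  | all z F ih | ex z F ih =>
    rw [subst]
    split_ifs with h
    · subst h
      intro w hw
      exact Or.inr ⟨hw, hw.2⟩
    · rintro w ⟨hw, hwz⟩
      rcases ih hw with rfl | ⟨h₁, h₂⟩
      · exact Or.inl rfl
      · exact Or.inr ⟨⟨h₁, hwz⟩, h₂⟩

theorem termSubst_var_cancel {t : L.Term ℕ} {x y : ℕ} (h : y ∉ termVar t) :
    termSubst (termSubst t x (.var y)) y (.var x) = t := by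
  rw [termSubst, termSubst, term_subst_subst]
  conv_rhs => rw [← term_subst_var t]
  refine term_subst_congr t fun z hz => ?_
  by_cases hzx : z = x
  · subst hzx
    simp [Term.subst]
  · have : z ≠ y := by rintro rfl; exact h hz
    simp [hzx, Term.subst, this]

theorem subst_var_cancel {F : Form L} {x y : ℕ} (h : y ∉ F.var) :
    (F.subst x (.var y)).subst y (.var x) = F := by
  induction F with
  | eq s t =>
    simp only [var, Set.mem_union, not_or] at h
    simp [subst, termSubst_var_cancel h.1, termSubst_var_cancel h.2]
  | rel p ts =>
    simp only [var, Set.mem_iUnion, not_exists] at h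
    simp [subst, termSubst_var_cancel (h _)]
  | neg F ih => simp [subst, ih h]
  | imp F G ih₁ ih₂ | and F G ih₁ ih₂ | or F G ih₁ ih₂ | iff F G ih₁ ih₂ =>
    simp only [var, Set.mem_union, not_or] at h
    simp [subst, ih₁ h.1, ih₂ h.2]
  | all z F ih | ex z F ih =>
    simp only [var, Set.mem_insert_iff, not_or] at h
    by_cases hz : z = x
    · have : y ∉ F.free := fun hy => h.2 (free_subset_var F hy)
      simp [subst, hz, subst_of_notMem_free _ this]
    · simp [subst, hz, Ne.symm h.1, ih h.2]

theorem collisionFree_subst_var {F : Form L} {x y : ℕ} (h : y ∉ F.var) :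
    (F.subst x (.var y)).CollisionFree y (.var x) := by
  induction F with
  | eq s t => trivial
  | rel p ts => trivial
  | neg F ih => exact ih h
  | imp F G ih₁ ih₂ | and F G ih₁ ih₂ | or F G ih₁ ih₂ | iff F G ih₁ ih₂ =>
    simp only [var, Set.mem_union, not_or] at h
    exact ⟨ih₁ h.1, ih₂ h.2⟩
  | all z F ih | ex z F ih =>
    rw [subst]
    split_ifs with hz
    · exact Or.inl fun hy => h (free_subset_var _ hy)
    · simp only [var, Set.mem_insert_iff, not_or] at h
      exact Or.inr ⟨hz, ih h.2⟩

end Form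

namespace System

open Form

variable {M : System L}

theorem Provable.all_subst_imp_all {F : Form L} (hF : F ∈ M.formulas) {x y : ℕ} (hxy : y ≠ x)
    (hy : y ∉ F.var) : M.Provable (.imp (.all y (F.subst x (.var y))) (.all x F)) := by
  have h := Provable.all_imp_subst (M := M) (F := F.subst x (.var y)) (s := .var x)
    (hF.subst x trivial) y trivial (collisionFree_subst_var hy)
  rw [subst_var_cancel hy] at h
  refine h.imp_all fun hx => ?_
  rcases free_subst_var F x y hx.1 with h | h
  · exact hxy h.symm
  · exact h.2 rfl

theorem Provable.all_rename {F : Form L} (hF : F ∈ M.formulas) {x y : ℕ} (hxy : y ≠ x)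
    (hy : y ∉ F.var) : M.Provable (.iff (.all x F) (.all y (F.subst x (.var y)))) :=
  .iff_intro ((Provable.all_imp_subst hF x (s := .var y) trivial
    (collisionFree_var x fun h => hy (bound_subset_var F h))).imp_all
      fun h => hy (free_subset_var F h.1)) (.all_subst_imp_all hF hxy hy)

theorem Provable.ex_rename {F : Form L} (hF : F ∈ M.formulas) {x y : ℕ} (hxy : y ≠ x)
    (hy : y ∉ F.var) : M.Provable (.iff (.ex x F) (.ex y (F.subst x (.var y)))) :=
  (Provable.exIff x hF).iff_trans ((Provable.all_rename (F := .neg F) hF hxy hy).neg_congr.iff_trans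
    (Provable.exIff y (hF.subst x (s := .var y) trivial)).iff_symm)

/-- Renaming of bound variables: every formula is equivalent, in every system, to a formula of
the same depth whose bound variables avoid a given finite set. -/
theorem exists_provable_iff_bound_disjoint (F : Form L) (V : Set ℕ) (hV : V.Finite) :
    ∃ G : Form L, G.depth = F.depth ∧ Disjoint V G.bound ∧
      ∀ M : System L, F ∈ M.formulas → M.Provable (.iff F G) := by
  have refl (M : System L) (F : Form L) (hF : F ∈ M.formulas) : M.Provable (.iff F F) :=
    .taut ⟨hF, hF⟩ fun τ => Iff.rfl
  induction F with
  | eq s t => exact ⟨.eq s t, rfl, by simp [bound], fun M => refl M _⟩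
  | rel p ts => exact ⟨.rel p ts, rfl, by simp [bound], fun M => refl M _⟩
  | neg F ih =>
    obtain ⟨G, h₁, h₂, h₃⟩ := ih
    exact ⟨.neg G, by simp [depth, h₁], h₂, fun M hM => (h₃ M hM).neg_congr⟩
  | imp F₁ F₂ ih₁ ih₂ | and F₁ F₂ ih₁ ih₂ | or F₁ F₂ ih₁ ih₂ | iff F₁ F₂ ih₁ ih₂ =>
    obtain ⟨G₁, h₁, h₂, h₃⟩ := ih₁
    obtain ⟨G₂, h₁', h₂', h₃'⟩ := ih₂
    first
    | refine ⟨.imp G₁ G₂, by simp [depth, h₁, h₁'], Set.disjoint_union_right.2 ⟨h₂, h₂'⟩,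
        fun M hM => ?_⟩
      refine .of_taut₂ (h₃ M hM.1) (h₃' M hM.2) ⟨hM,
        (h₃ M hM.1).mem_formulas.2, (h₃' M hM.2).mem_formulas.2⟩ ?_
      simp only [Form.propTruth]
      exact fun τ => imp_congr
    | refine ⟨.and G₁ G₂, by simp [depth, h₁, h₁'], Set.disjoint_union_right.2 ⟨h₂, h₂'⟩,
        fun M hM => ?_⟩
      refine .of_taut₂ (h₃ M hM.1) (h₃' M hM.2) ⟨hM,
        (h₃ M hM.1).mem_formulas.2, (h₃' M hM.2).mem_formulas.2⟩ ?_
      simp only [Form.propTruth]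
      exact fun τ => and_congr
    | refine ⟨.or G₁ G₂, by simp [depth, h₁, h₁'], Set.disjoint_union_right.2 ⟨h₂, h₂'⟩,
        fun M hM => ?_⟩
      refine .of_taut₂ (h₃ M hM.1) (h₃' M hM.2) ⟨hM,
        (h₃ M hM.1).mem_formulas.2, (h₃' M hM.2).mem_formulas.2⟩ ?_
      simp only [Form.propTruth]
      exact fun τ => or_congr
    | refine ⟨.iff G₁ G₂, by simp [depth, h₁, h₁'], Set.disjoint_union_right.2 ⟨h₂, h₂'⟩,
        fun M hM => ?_⟩
      refine .of_taut₂ (h₃ M hM.1) (h₃' M hM.2) ⟨hM,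
        (h₃ M hM.1).mem_formulas.2, (h₃' M hM.2).mem_formulas.2⟩ ?_
      simp only [Form.propTruth]
      exact fun τ => iff_congr
  | all x F ih =>
    obtain ⟨G, h₁, h₂, h₃⟩ := ih
    obtain ⟨y, hy⟩ := ((hV.union G.finite_var).insert x).exists_notMem
    simp only [Set.mem_insert_iff, Set.mem_union, not_or] at hy
    obtain ⟨hyx, hyV, hyG⟩ := hy
    refine ⟨.all y (G.subst x (.var y)), by simp [depth, depth_subst, h₁], ?_, fun M hM => ?_⟩
    · rw [bound, bound_subst, Set.disjoint_insert_right]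
      exact ⟨hyV, h₂⟩
    · exact ((h₃ M hM).all_congr x).iff_trans (.all_rename (h₃ M hM).mem_formulas.2 hyx hyG)
  | ex x F ih =>
    obtain ⟨G, h₁, h₂, h₃⟩ := ih
    obtain ⟨y, hy⟩ := ((hV.union G.finite_var).insert x).exists_notMem
    simp only [Set.mem_insert_iff, Set.mem_union, not_or] at hy
    obtain ⟨hyx, hyV, hyG⟩ := hy
    refine ⟨.ex y (G.subst x (.var y)), by simp [depth, depth_subst, h₁], ?_, fun M hM => ?_⟩
    · rw [bound, bound_subst, Set.disjoint_insert_right]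
      exact ⟨hyV, h₂⟩
    · exact ((h₃ M hM).ex_congr x).iff_trans (.ex_rename (h₃ M hM).mem_formulas.2 hyx hyG)

end System

/-! ### Simultaneous substitution into quantifier-free formulas -/

namespace Form

/-- The formula contains no quantifier. -/
def QF : Form L → Prop
  | eq _ _ => True
  | rel _ _ => True
  | neg F => F.QF
  | imp F G => F.QF ∧ G.QF
  | and F G => F.QF ∧ G.QF
  | or F G => F.QF ∧ G.QF
  | iff F G => F.QF ∧ G.QF
  | all _ _ => False
  | ex _ _ => False

/-- Simultaneous substitution of terms for the variables of a quantifier-free formula; quantified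
formulas are left alone. -/
def msubst (σ : ℕ → L.Term ℕ) : Form L → Form L
  | eq s t => eq (s.subst σ) (t.subst σ)
  | rel p ts => rel p fun i => (ts i).subst σ
  | neg F => neg (F.msubst σ)
  | imp F G => imp (F.msubst σ) (G.msubst σ)
  | and F G => and (F.msubst σ) (G.msubst σ)
  | or F G => or (F.msubst σ) (G.msubst σ)
  | iff F G => iff (F.msubst σ) (G.msubst σ)
  | all x F => all x F
  | ex x F => ex x F

theorem QF.collisionFree {F : Form L} (hF : F.QF) (x : ℕ) (s : L.Term ℕ) :
    F.CollisionFree x s := by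
  induction F with
  | eq s t => trivial
  | rel p ts => trivial
  | neg F ih => exact ih hF
  | imp F G ih₁ ih₂ | and F G ih₁ ih₂ | or F G ih₁ ih₂ | iff F G ih₁ ih₂ =>
    exact ⟨ih₁ hF.1, ih₂ hF.2⟩
  | all x F | ex x F => exact hF.elim

theorem QF.msubst {F : Form L} (hF : F.QF) (σ : ℕ → L.Term ℕ) : (F.msubst σ).QF := by
  induction F with
  | eq s t => trivial
  | rel p ts => trivial
  | neg F ih => exact ih hF
  | imp F G ih₁ ih₂ | and F G ih₁ ih₂ | or F G ih₁ ih₂ | iff F G ih₁ ih₂ =>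
    exact ⟨ih₁ hF.1, ih₂ hF.2⟩
  | all x F | ex x F => exact hF.elim

theorem msubst_congr {F : Form L} {σ σ' : ℕ → L.Term ℕ} (h : ∀ x ∈ F.var, σ x = σ' x) :
    F.msubst σ = F.msubst σ' := by
  induction F with
  | eq s t =>
    simp [msubst, term_subst_congr s fun x hx => h x (Or.inl hx),
      term_subst_congr t fun x hx => h x (Or.inr hx)]
  | rel p ts =>
    simp [msubst, fun i => term_subst_congr (ts i) fun x hx => h x (Set.mem_iUnion_of_mem i hx)]
  | neg F ih => simp [msubst, ih h]
  | imp F G ih₁ ih₂ | and F G ih₁ ih₂ | or F G ih₁ ih₂ | iff F G ih₁ ih₂ =>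
    simp [msubst, ih₁ fun x hx => h x (Or.inl hx), ih₂ fun x hx => h x (Or.inr hx)]
  | all x F | ex x F => rfl

theorem msubst_var (F : Form L) : F.msubst Term.var = F := by
  induction F with
  | eq s t => simp [msubst, term_subst_var]
  | rel p ts => simp [msubst, term_subst_var]
  | neg F ih => simp [msubst, ih]
  | imp F G ih₁ ih₂ | and F G ih₁ ih₂ | or F G ih₁ ih₂ | iff F G ih₁ ih₂ =>
    simp [msubst, ih₁, ih₂]
  | all x F | ex x F => rfl

theorem QF.msubst_msubst {F : Form L} (hF : F.QF) (σ σ' : ℕ → L.Term ℕ) :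
    (F.msubst σ).msubst σ' = F.msubst fun x => (σ x).subst σ' := by
  induction F with
  | eq s t => simp [Form.msubst, term_subst_subst]
  | rel p ts => simp [Form.msubst, term_subst_subst]
  | neg F ih => simp [Form.msubst, ih hF]
  | imp F G ih₁ ih₂ | and F G ih₁ ih₂ | or F G ih₁ ih₂ | iff F G ih₁ ih₂ =>
    simp [Form.msubst, ih₁ hF.1, ih₂ hF.2]
  | all x F | ex x F => exact hF.elim

theorem QF.subst_eq_msubst {F : Form L} (hF : F.QF) (x : ℕ) (s : L.Term ℕ) :
    F.subst x s = F.msubst (Function.update Term.var x s) := by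
  induction F with
  | eq s t => rfl
  | rel p ts => rfl
  | neg F ih => simp [Form.msubst, Form.subst, ih hF]
  | imp F G ih₁ ih₂ | and F G ih₁ ih₂ | or F G ih₁ ih₂ | iff F G ih₁ ih₂ =>
    simp [Form.msubst, Form.subst, ih₁ hF.1, ih₂ hF.2]
  | all x F | ex x F => exact hF.elim

theorem QF.foldr_imp {Γ : List (Form L)} {F : Form L} (hΓ : ∀ G ∈ Γ, G.QF) (hF : F.QF) :
    (Γ.foldr imp F).QF := by
  induction Γ with
  | nil => exact hF
  | cons G Γ ih =>
    simp only [List.forall_mem_cons] at hΓ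
    exact ⟨hΓ.1, ih hΓ.2⟩

theorem msubst_foldr_imp (Γ : List (Form L)) (F : Form L) (σ : ℕ → L.Term ℕ) :
    (Γ.foldr imp F).msubst σ = (Γ.map (msubst σ)).foldr imp (F.msubst σ) := by
  induction Γ with
  | nil => rfl
  | cons G Γ ih => simp [msubst, ih]

end Form

namespace System

open Form

variable {M : System L}

/-- If the substituted terms contain none of the replaced variables, a simultaneous substitution
amounts to single substitutions carried out one after the other. -/
theorem Provable.msubst_of_disjoint {F : Form L} (hF : F.QF) (h : M.Provable F) (S : Finset ℕ)
    (σ : ℕ → L.Term ℕ) (hσ : ∀ x, σ x ∈ M.terms) (hS : ∀ x ∈ S, ∀ y ∈ S, y ∉ termVar (σ x))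
    (hS' : ∀ x ∉ S, σ x = .var x) : M.Provable (F.msubst σ) := by
  induction S using Finset.induction_on generalizing σ with
  | empty =>
    obtain rfl : σ = Term.var := funext fun x => hS' x (by simp)
    rwa [msubst_var]
  | insert a S ha ih =>
    have h' := ih (Function.update σ a (.var a))
      (TermOver.update hσ a (by simp [TermOver]))
      (fun x hx y hy => by
        rw [Function.update_of_ne (by rintro rfl; exact ha hx)]
        exact hS x (by simp [hx]) y (by simp [hy]))
      (fun x hx => by
        by_cases hxa : x = a
        · subst hxa; simp
        · simpa [hxa] using hS' x (by simp [hx, hxa]))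
    have h'' := Provable.subst a (σ a) h' (hσ a) ((hF.msubst _).collisionFree _ _)
    rw [(hF.msubst _).subst_eq_msubst, hF.msubst_msubst] at h''
    convert h'' using 2
    funext x
    by_cases hxa : x = a
    · subst hxa; simp [Term.subst]
    · rw [Function.update_of_ne hxa]
      by_cases hx : x ∈ S
      · exact (termSubst_of_notMem (σ a) (hS x (by simp [hx]) a (by simp))).symm
      · rw [hS' x (by simp [hx, hxa])]
        simp [Term.subst, hxa]

/-- Simultaneous substitution is a derived rule for quantifier-free formulas: the variables are
first moved out of the way of the substituted terms. -/
theorem Provable.msubst {F : Form L} (hF : F.QF) (h : M.Provable F)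
    (σ : ℕ → L.Term ℕ) (hσ : ∀ x, σ x ∈ M.terms) : M.Provable (F.msubst σ) := by
  classical
  have hfin : (F.var ∪ ⋃ x ∈ F.var, termVar (σ x)).Finite :=
    F.finite_var.union (F.finite_var.biUnion fun x _ => finite_termVar _)
  obtain ⟨K, hK⟩ := hfin.bddAbove
  have hK₁ : ∀ x ∈ F.var, x ≤ K := fun x hx => hK (Or.inl hx)
  have hK₂ : ∀ x ∈ F.var, ∀ y ∈ termVar (σ x), y ≤ K :=
    fun x hx y hy => hK (Or.inr (Set.mem_biUnion hx hy))
  set S := F.finite_var.toFinset with hSdef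
  have hS : ∀ x, x ∈ S ↔ x ∈ F.var := fun x => by simp [hSdef]
  let σ₁ : ℕ → L.Term ℕ := fun x => if x ∈ S then .var (x + (K + 1)) else .var x
  let σ₂ : ℕ → L.Term ℕ := fun x => if x ∈ S.image (· + (K + 1)) then σ (x - (K + 1)) else .var x
  have h₁ : M.Provable (F.msubst σ₁) := by
    refine h.msubst_of_disjoint hF S σ₁ (fun x => ?_) (fun x hx y hy => ?_) (fun x hx => ?_)
    · simp only [σ₁]; split_ifs <;> trivial
    · simp only [σ₁, if_pos hx, termVar, Set.mem_singleton_iff]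
      have := hK₁ y ((hS y).1 hy)
      omega
    · simp only [σ₁, if_neg hx]
  have h₂ : M.Provable ((F.msubst σ₁).msubst σ₂) := by
    refine h₁.msubst_of_disjoint (hF.msubst _) (S.image (· + (K + 1))) σ₂ (fun x => ?_)
      (fun x hx y hy => ?_) (fun x hx => ?_)
    · simp only [σ₂]
      split_ifs
      · exact hσ _
      · trivial
    · simp only [σ₂, if_pos hx]
      obtain ⟨x, hxS, rfl⟩ := Finset.mem_image.1 hx
      obtain ⟨y, hy, rfl⟩ := Finset.mem_image.1 hy
      simp only [Nat.add_sub_cancel]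
      intro hmem
      have := hK₂ x ((hS x).1 hxS) _ hmem
      omega
    · simp only [σ₂, if_neg hx]
  rw [hF.msubst_msubst] at h₂
  convert h₂ using 1
  refine msubst_congr fun x hx => ?_
  have hxS := (hS x).2 hx
  simp only [σ₁, if_pos hxS, Term.subst, σ₂, if_pos (Finset.mem_image_of_mem _ hxS),
    Nat.add_sub_cancel]

theorem Provable.eq_refl {t : L.Term ℕ} (ht : t ∈ M.terms) : M.Provable (.eq t t) :=
  (Provable.eqRefl (M := M) 0).msubst (by simp [eqv, QF]) (fun _ => t) fun _ => ht

theorem Provable.eq_eq {s s' t t' : L.Term ℕ} (hs : s ∈ M.terms) (hs' : s' ∈ M.terms)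
    (ht : t ∈ M.terms) (ht' : t' ∈ M.terms) :
    M.Provable (.imp (.eq s s') (.imp (.eq t t') (.imp (.eq s t) (.eq s' t')))) :=
  (Provable.eqEq (M := M) 0 1 2 3).msubst (by simp [eqv, QF])
    (fun | 0 => s | 1 => s' | 2 => t | _ => t')
    (fun | 0 => hs | 1 => hs' | 2 => ht | _ + 3 => ht')

theorem Provable.impChain_msubst {n : ℕ} {xs ys : Fin n → ℕ} {F : Form L} (hF : F.QF)
    (h : M.Provable (impChain (fun i => eqv (xs i) (ys i)) F))
    (σ : ℕ → L.Term ℕ) (hσ : ∀ x, σ x ∈ M.terms) :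
    M.Provable (impChain (fun i => .eq (σ (xs i)) (σ (ys i))) (F.msubst σ)) := by
  have hQ : (impChain (fun i => eqv (xs i) (ys i)) F).QF :=
    QF.foldr_imp (by simp [eqv, QF]) hF
  have h' := h.msubst hQ σ hσ
  rw [impChain, msubst_foldr_imp, List.map_ofFn] at h'
  exact h'

/-- The terms `ss` followed by the terms `ts`, as a substitution. -/
theorem exists_subst_append {n : ℕ} {ss ts : Fin n → L.Term ℕ} (hs : ∀ i, ss i ∈ M.terms)
    (ht : ∀ i, ts i ∈ M.terms) : ∃ σ : ℕ → L.Term ℕ, (∀ x, σ x ∈ M.terms) ∧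
      (∀ i : Fin n, σ i = ss i) ∧ ∀ i : Fin n, σ (n + i) = ts i := by
  refine ⟨fun x => if h : x < n then ss ⟨x, h⟩ else if h : x - n < n then ts ⟨x - n, h⟩ else .var 0,
    fun x => ?_, fun i => by simp, fun i => by simp⟩
  dsimp only
  split_ifs
  · exact hs _
  · exact ht _
  · trivial

theorem Provable.eq_func {n : ℕ} {f : L.Functions n} (hf : ⟨n, f⟩ ∈ M.A) {ss ts : Fin n → L.Term ℕ}
    (hs : ∀ i, ss i ∈ M.terms) (ht : ∀ i, ts i ∈ M.terms) :
    M.Provable (impChain (fun i => .eq (ss i) (ts i)) (.eq (.func f ss) (.func f ts))) := by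
  obtain ⟨σ, h, h₁, h₂⟩ := exists_subst_append hs ht
  have := (Provable.eqFun (M := M) f (fun i => i) (fun i => n + i) hf).impChain_msubst
    (by trivial) σ h
  simpa only [Form.msubst, Term.subst, h₁, h₂] using this

theorem Provable.eq_rel {n : ℕ} {p : L.Relations n} (hp : ⟨n, p⟩ ∈ M.P) {ss ts : Fin n → L.Term ℕ}
    (hs : ∀ i, ss i ∈ M.terms) (ht : ∀ i, ts i ∈ M.terms) :
    M.Provable (impChain (fun i => .eq (ss i) (ts i)) (.imp (.rel p ss) (.rel p ts))) := by
  obtain ⟨σ, h, h₁, h₂⟩ := exists_subst_append hs ht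
  have := (Provable.eqRel (M := M) p (fun i => i) (fun i => n + i) hp).impChain_msubst
    (by simp [QF]) σ h
  simpa only [Form.msubst, Term.subst, h₁, h₂] using this

end System

end Calculus

end SetTh

namespace SetTh

open FirstOrder.Language (Term)

section Completeness

variable {L : FirstOrder.Language.{u, v}}

/-! ### Countability of the set of formulas -/

theorem countable_termOver {A : Set (Σ n, L.Functions n)} (hA : A.Countable) :
    {t : L.Term ℕ | TermOver A t}.Countable := by
  -- `S k` contains the terms of nesting depth less than `k`
  let S : ℕ → Set (L.Term ℕ) := fun k => Nat.rec ∅ (fun _ S => Set.range Term.var ∪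
    ⋃ f ∈ A, (Term.func f.2) '' {ts | ∀ i, ts i ∈ S}) k
  have hS (k : ℕ) : S (k + 1) = Set.range Term.var ∪
    ⋃ f ∈ A, (Term.func f.2) '' {ts | ∀ i, ts i ∈ S k} := rfl
  have hcount (k : ℕ) : (S k).Countable := by
    induction k with
    | zero => exact Set.countable_empty
    | succ k ih =>
      rw [hS]
      exact (Set.countable_range _).union
        (hA.biUnion fun f _ => (Set.countable_pi fun _ => ih).image _)
  have hmono : Monotone S := by
    refine monotone_nat_of_le_succ fun k => ?_
    induction k with
    | zero => exact Set.empty_subset _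
    | succ k ih =>
      rw [hS, hS (k + 1)]
      refine Set.union_subset_union_right _ (Set.iUnion₂_mono fun f _ => Set.image_mono ?_)
      exact fun ts hts i => ih (hts i)
  refine (Set.countable_iUnion hcount).mono fun t ht => Set.mem_iUnion.2 ?_
  induction t with
  | var x => exact ⟨1, Or.inl ⟨x, rfl⟩⟩
  | func f ts ih =>
    choose k hk using fun i => ih i (ht.2 i)
    refine ⟨Finset.univ.sup k + 1, Or.inr (Set.mem_biUnion ht.1 ⟨ts, fun i => ?_, rfl⟩)⟩
    exact hmono (Finset.le_sup (Finset.mem_univ i)) (hk i)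

theorem System.countable_formulas {M : System L} (hA : M.A.Countable) (hP : M.P.Countable) :
    M.formulas.Countable := by
  have hT := countable_termOver hA
  let S : ℕ → Set (Form L) := fun k => Nat.rec
    (Set.image2 Form.eq M.terms M.terms ∪ ⋃ p ∈ M.P, (Form.rel p.2) '' {ts | ∀ i, ts i ∈ M.terms})
    (fun _ S => S ∪ Form.neg '' S ∪ Set.image2 Form.imp S S ∪ Set.image2 Form.and S S ∪
      Set.image2 Form.or S S ∪ Set.image2 Form.iff S S ∪ Set.image2 Form.all Set.univ S ∪
      Set.image2 Form.ex Set.univ S) k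
  have hS (k : ℕ) : S (k + 1) = S k ∪ Form.neg '' S k ∪ Set.image2 Form.imp (S k) (S k) ∪
      Set.image2 Form.and (S k) (S k) ∪ Set.image2 Form.or (S k) (S k) ∪
      Set.image2 Form.iff (S k) (S k) ∪ Set.image2 Form.all Set.univ (S k) ∪
      Set.image2 Form.ex Set.univ (S k) := rfl
  have hcount (k : ℕ) : (S k).Countable := by
    induction k with
    | zero =>
      exact (hT.image2 hT _).union (hP.biUnion fun p _ => (Set.countable_pi fun _ => hT).image _)
    | succ k ih =>
      rw [hS]
      exact (((((((ih.union (ih.image _)).union (ih.image2 ih _)).union (ih.image2 ih _)).union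
        (ih.image2 ih _)).union (ih.image2 ih _)).union (Set.countable_univ.image2 ih _)).union
        (Set.countable_univ.image2 ih _))
  have hmono : Monotone S := by
    refine monotone_nat_of_le_succ fun k => ?_
    rw [hS]
    intro F hF
    simp [hF]
  refine (Set.countable_iUnion hcount).mono fun F hF => Set.mem_iUnion.2 ?_
  induction F with
  | eq s t => exact ⟨0, Or.inl (Set.mem_image2_of_mem hF.1 hF.2)⟩
  | rel p ts => exact ⟨0, Or.inr (Set.mem_biUnion hF.1 ⟨ts, hF.2, rfl⟩)⟩
  | neg F ih =>
    obtain ⟨k, hk⟩ := ih hF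
    exact ⟨k + 1, by rw [hS]; simp [hk]⟩
  | imp F G ih₁ ih₂ | and F G ih₁ ih₂ | or F G ih₁ ih₂ | iff F G ih₁ ih₂ =>
    obtain ⟨k, hk⟩ := ih₁ hF.1
    obtain ⟨l, hl⟩ := ih₂ hF.2
    have hk' := hmono (le_max_left k l) hk
    have hl' := hmono (le_max_right k l) hl
    exact ⟨max k l + 1, by rw [hS]; simp [hk', hl']⟩
  | all x F ih | ex x F ih =>
    obtain ⟨k, hk⟩ := ih hF
    exact ⟨k + 1, by rw [hS]; simp [hk]⟩

/-! ### Henkin sets -/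

namespace System

open Form

/-- A maximal consistent set of formulas of `M`, closed under derivations without generalization
and substitution, in which every existential formula has a variable as a witness. -/
structure IsHenkin (M : System L) (T : Set (Form L)) : Prop where
  subset : T ⊆ M.formulas
  closed : ∀ Γ : List (Form L), (∀ G ∈ Γ, G ∈ T) → ∀ H, M.Provable (Γ.foldr imp H) → H ∈ T
  neg_mem : ∀ H ∈ M.formulas, (neg H ∈ T ↔ H ∉ T)
  witness : ∀ x H, ex x H ∈ T → ∃ y ∉ H.var, H.subst x (.var y) ∈ T

variable {M : System L}

/-- A list of hypotheses from which `F` is not derivable can be enlarged so as to decide a given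
formula `G`, with a fresh variable as a witness if `G` is an existential formula which is
accepted. -/
theorem exists_henkin_step {F : Form L} (hF : F ∈ M.formulas) {Γ : List (Form L)}
    (hΓ : ∀ G ∈ Γ, G ∈ M.formulas) (hc : ¬ M.Provable (Γ.foldr imp F)) {G : Form L}
    (hG : G ∈ M.formulas) : ∃ Γ' : List (Form L), (∀ G ∈ Γ', G ∈ M.formulas) ∧
      ¬ M.Provable (Γ'.foldr imp F) ∧ Γ ⊆ Γ' ∧ (neg G ∈ Γ' ∨ (G ∈ Γ' ∧
        ∀ x H, G = ex x H → ∃ y ∉ H.var, H.subst x (.var y) ∈ Γ')) := by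
  have hΓF : Γ.foldr imp F ∈ M.formulas := over_foldr_imp hΓ hF
  by_cases hGc : M.Provable ((G :: Γ).foldr imp F)
  · refine ⟨neg G :: Γ, List.forall_mem_cons.2 ⟨hG, hΓ⟩, fun h => hc ?_, List.subset_cons_self _ _,
      Or.inl (by simp)⟩
    refine .of_taut₂ hGc h hΓF ?_
    simp only [List.foldr, propTruth]
    tauto
  · by_cases hex : ∃ x H, G = ex x H
    · obtain ⟨x, H, rfl⟩ := hex
      obtain ⟨y, hy⟩ := ((ex x H).finite_var.union (Γ.foldr imp F).finite_var).exists_notMem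
      simp only [var, Set.mem_union, Set.mem_insert_iff, not_or] at hy
      obtain ⟨⟨hyx, hyH⟩, hyΓ⟩ := hy
      refine ⟨H.subst x (.var y) :: ex x H :: Γ, ?_, fun h => hGc ?_, ?_, Or.inr ⟨by simp, ?_⟩⟩
      · simp only [List.forall_mem_cons]
        exact ⟨Over.subst (F := H) (s := .var y) hG x trivial, hG, hΓ⟩
      · -- as `y` is fresh, the witness can be generalized away
        set C := Γ.foldr imp F with hC
        have h₁ : M.Provable (imp (neg (imp (ex x H) C)) (neg (H.subst x (.var y)))) := by
          refine .of_taut₁ h ⟨⟨hG, hΓF⟩, Over.subst (F := H) (s := .var y) hG x trivial⟩ ?_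
          simp only [List.foldr, propTruth, ← hC]
          tauto
        have hyf : y ∉ (neg (imp (ex x H) C)).free := fun hyf =>
          hyf.elim (fun h => hyH (free_subset_var _ h.1)) (fun h => hyΓ (free_subset_var _ h))
        have h₂ := h₁.imp_all hyf
        have h₃ := Provable.all_subst_imp_all (M := M) (F := neg H) hG hyx hyH
        refine .of_taut [_, _, _] (List.forall_mem_cons.2 ⟨h₂, List.forall_mem_cons.2
          ⟨h₃, List.forall_mem_cons.2 ⟨.exIff (F := H) x hG, by simp⟩⟩⟩) ⟨hG, hΓF⟩ ?_
        simp only [List.forall_mem_cons, propTruth, subst, List.foldr, ← hC]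
        tauto
      · exact fun K hK => by simp [hK]
      · rintro x' H' h
        cases h
        exact ⟨y, hyH, by simp⟩
    · refine ⟨G :: Γ, List.forall_mem_cons.2 ⟨hG, hΓ⟩, hGc, List.subset_cons_self _ _,
        Or.inr ⟨by simp, fun x H h => (hex ⟨x, H, h⟩).elim⟩⟩

theorem exists_isHenkin (hcount : M.formulas.Countable) {F : Form L} (hF : F ∈ M.formulas)
    (hc : ¬ M.Provable F) : ∃ T, M.IsHenkin T ∧ F ∉ T := by
  obtain ⟨e, he⟩ := hcount.exists_eq_range ⟨F, hF⟩
  have hmem (n : ℕ) : e n ∈ M.formulas := he ▸ Set.mem_range_self n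
  let State := {Γ : List (Form L) // (∀ G ∈ Γ, G ∈ M.formulas) ∧ ¬ M.Provable (Γ.foldr imp F)}
  choose next h₁ h₂ h₃ h₄ using fun (Γ : State) (n : ℕ) =>
    exists_henkin_step hF Γ.2.1 Γ.2.2 (hmem n)
  let c : ℕ → State := fun n => Nat.rec ⟨[], by simp, hc⟩
    (fun n Γ => ⟨next Γ n, h₁ Γ n, h₂ Γ n⟩) n
  have hcs (n : ℕ) : (c (n + 1)).1 = next (c n) n := rfl
  have hmono : ∀ {m n : ℕ}, m ≤ n → (c m).1 ⊆ (c n).1 := by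
    intro m n hmn
    induction n, hmn using Nat.le_induction with
    | base => exact List.Subset.refl _
    | succ n _ ih => exact List.Subset.trans ih (by rw [hcs]; exact h₃ (c n) n)
  let T : Set (Form L) := {G | ∃ n, G ∈ (c n).1}
  have hlist (Γ : List (Form L)) (hΓ : ∀ G ∈ Γ, G ∈ T) : ∃ n, Γ ⊆ (c n).1 := by
    induction Γ with
    | nil => exact ⟨0, by simp⟩
    | cons G Γ ih =>
      simp only [List.forall_mem_cons] at hΓ
      obtain ⟨⟨m, hm⟩, hΓ⟩ := hΓ
      obtain ⟨n, hn⟩ := ih hΓ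
      refine ⟨max m n, List.cons_subset.2 ⟨hmono (le_max_left _ _) hm, ?_⟩⟩
      exact List.Subset.trans hn (hmono (le_max_right _ _))
  have hcons (Γ : List (Form L)) (hΓ : ∀ G ∈ Γ, G ∈ T) : ¬ M.Provable (Γ.foldr imp F) := by
    intro h
    obtain ⟨n, hn⟩ := hlist Γ hΓ
    refine (c n).2.2 (.of_taut₁ h (over_foldr_imp (c n).2.1 hF) fun τ => ?_)
    simp only [propTruth_foldr_imp]
    exact fun h h' => h fun G hG => h' G (hn hG)
  have hdec (H : Form L) (hH : H ∈ M.formulas) : neg H ∈ T ∨ (H ∈ T ∧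
      ∀ x H', H = ex x H' → ∃ y ∉ H'.var, H'.subst x (.var y) ∈ T) := by
    rw [he] at hH
    obtain ⟨n, rfl⟩ := hH
    rcases h₄ (c n) n with h | ⟨h, h'⟩
    · exact Or.inl ⟨n + 1, h⟩
    · exact Or.inr ⟨⟨n + 1, h⟩, fun x H' hx => (h' x H' hx).imp fun y hy => ⟨hy.1, n + 1, hy.2⟩⟩
  have hsub : T ⊆ M.formulas := fun G ⟨n, hn⟩ => (c n).2.1 G hn
  have hnot (H : Form L) (hH : H ∈ T) : neg H ∉ T := by
    intro hH'
    refine hcons [H, neg H] (by simp [hH, hH']) (.taut ⟨hsub hH, hsub hH, hF⟩ fun τ => ?_)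
    simp only [List.foldr, propTruth]
    tauto
  refine ⟨T, ⟨hsub, fun Γ hΓ H hH => ?_, fun H hH => ⟨fun h h' => hnot H h' h, fun h => ?_⟩,
    fun x H hH => ?_⟩, fun hFT => ?_⟩
  · have hHf : H ∈ M.formulas := by
      have := hH.mem_formulas
      clear hH
      induction Γ with
      | nil => exact this
      | cons G Γ ih => exact ih (fun G hG => hΓ G (by simp [hG])) this.2
    rcases hdec H hHf with h | h
    · refine (hcons (neg H :: Γ) (List.forall_mem_cons.2 ⟨h, hΓ⟩) (.of_taut₁ hH
        ⟨hHf, over_foldr_imp (fun G hG => hsub (hΓ G hG)) hF⟩ fun τ => ?_)).elim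
      simp only [List.foldr, propTruth, propTruth_foldr_imp]
      tauto
    · exact h.1
  · rcases hdec H hH with h' | h'
    · exact h'
    · exact (h h'.1).elim
  · rcases hdec _ (hsub hH) with h | h
    · exact (hnot _ hH h).elim
    · exact h.2 x H rfl
  · refine hcons [F] (by simp [hFT]) (.taut ⟨hF, hF⟩ fun τ => ?_)
    simp [propTruth]

/-! ### The term model -/

namespace IsHenkin

variable {T : Set (Form L)}

theorem mem_of_provable (hT : M.IsHenkin T) {F : Form L} (h : M.Provable F) : F ∈ T :=
  hT.closed [] (by simp) F h

theorem mp (hT : M.IsHenkin T) {F G : Form L} (h : M.Provable (imp F G)) (hF : F ∈ T) : G ∈ T :=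
  hT.closed [F] (by simp [hF]) G h

theorem mem_iff_of_provable (hT : M.IsHenkin T) {F G : Form L} (h : M.Provable (iff F G)) :
    F ∈ T ↔ G ∈ T :=
  ⟨hT.mp h.imp_of_iff, hT.mp h.iff_symm.imp_of_iff⟩

theorem mem_of_impChain (hT : M.IsHenkin T) {n : ℕ} {H : Fin n → Form L} {F : Form L}
    (h : M.Provable (impChain H F)) (hH : ∀ i, H i ∈ T) : F ∈ T :=
  hT.closed (List.ofFn H) (by simpa [List.forall_mem_ofFn_iff] using hH) F h

theorem mem_of_taut (hT : M.IsHenkin T) (Γ : List (Form L)) (hΓ : ∀ G ∈ Γ, G ∈ T) {H : Form L}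
    (hH : H ∈ M.formulas) (h : ∀ τ, (∀ G ∈ Γ, G.propTruth τ) → H.propTruth τ) : H ∈ T :=
  hT.closed Γ hΓ H (.taut (over_foldr_imp (fun G hG => hT.subset (hΓ G hG)) hH)
    fun τ => (propTruth_foldr_imp Γ H τ).2 (h τ))

theorem mem_of_taut₁ (hT : M.IsHenkin T) {G H : Form L} (hG : G ∈ T) (hH : H ∈ M.formulas)
    (h : ∀ τ, G.propTruth τ → H.propTruth τ) : H ∈ T :=
  hT.mem_of_taut [G] (by simpa using hG) hH (by simpa using h)

theorem mem_of_taut₂ (hT : M.IsHenkin T) {G G' H : Form L} (hG : G ∈ T) (hG' : G' ∈ T)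
    (hH : H ∈ M.formulas) (h : ∀ τ, G.propTruth τ → G'.propTruth τ → H.propTruth τ) : H ∈ T :=
  hT.mem_of_taut [G, G'] (by simpa using ⟨hG, hG'⟩) hH (by simpa using h)

theorem imp_mem (hT : M.IsHenkin T) {F G : Form L} (hF : F ∈ M.formulas) (hG : G ∈ M.formulas) :
    imp F G ∈ T ↔ (F ∈ T → G ∈ T) := by
  refine ⟨fun h h' => hT.mem_of_taut₂ h h' hG fun τ => by simp only [propTruth]; tauto,
    fun h => ?_⟩
  by_cases hFT : F ∈ T
  · exact hT.mem_of_taut₁ (h hFT) ⟨hF, hG⟩ fun τ => by simp only [propTruth]; tauto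
  · exact hT.mem_of_taut₁ ((hT.neg_mem F hF).2 hFT) ⟨hF, hG⟩ fun τ => by
      simp only [propTruth]; tauto

theorem and_mem (hT : M.IsHenkin T) {F G : Form L} (hF : F ∈ M.formulas) (hG : G ∈ M.formulas) :
    and F G ∈ T ↔ (F ∈ T ∧ G ∈ T) :=
  ⟨fun h => ⟨hT.mem_of_taut₁ h hF fun τ => by simp only [propTruth]; tauto,
    hT.mem_of_taut₁ h hG fun τ => by simp only [propTruth]; tauto⟩,
   fun h => hT.mem_of_taut₂ h.1 h.2 ⟨hF, hG⟩ fun τ => by simp only [propTruth]; tauto⟩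

theorem or_mem (hT : M.IsHenkin T) {F G : Form L} (hF : F ∈ M.formulas) (hG : G ∈ M.formulas) :
    or F G ∈ T ↔ (F ∈ T ∨ G ∈ T) := by
  refine ⟨fun h => or_iff_not_imp_left.2 fun hFT => ?_, fun h => h.elim
    (fun h => hT.mem_of_taut₁ h ⟨hF, hG⟩ fun τ => by simp only [propTruth]; tauto)
    (fun h => hT.mem_of_taut₁ h ⟨hF, hG⟩ fun τ => by simp only [propTruth]; tauto)⟩
  exact hT.mem_of_taut₂ h ((hT.neg_mem F hF).2 hFT) hG fun τ => by simp only [propTruth]; tauto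

theorem iff_mem (hT : M.IsHenkin T) {F G : Form L} (hF : F ∈ M.formulas) (hG : G ∈ M.formulas) :
    iff F G ∈ T ↔ (F ∈ T ↔ G ∈ T) := by
  have h : M.Provable (iff (iff F G) (and (imp F G) (imp G F))) :=
    .taut ⟨⟨hF, hG⟩, ⟨hF, hG⟩, hG, hF⟩ fun τ => by simp only [propTruth]; tauto
  rw [hT.mem_iff_of_provable h, hT.and_mem (F := imp F G) (G := imp G F) ⟨hF, hG⟩ ⟨hG, hF⟩, hT.imp_mem hF hG, hT.imp_mem hG hF]
  exact iff_iff_implies_and_implies.symm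

theorem eq_symm (hT : M.IsHenkin T) {s t : L.Term ℕ} (h : eq s t ∈ T) : eq t s ∈ T := by
  obtain ⟨hs, ht⟩ := hT.subset h
  have hss := hT.mem_of_provable (.eq_refl (M := M) (t := s) hs)
  exact hT.closed [eq s t, eq s s, eq s s] (by simp [h, hss]) _ (.eq_eq hs ht hs hs)

theorem eq_trans (hT : M.IsHenkin T) {s t r : L.Term ℕ} (h : eq s t ∈ T) (h' : eq t r ∈ T) :
    eq s r ∈ T := by
  obtain ⟨hs, ht⟩ := hT.subset h
  obtain ⟨-, hr⟩ := hT.subset h'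
  have hss := hT.mem_of_provable (.eq_refl (M := M) (t := s) hs)
  exact hT.closed [eq s s, eq t r, eq s t] (by simp [h, hss, h']) _ (.eq_eq hs hs ht hr)

theorem exists_var_eq (hT : M.IsHenkin T) {t : L.Term ℕ} (ht : t ∈ M.terms) :
    ∃ y, eq (.var y) t ∈ T := by
  obtain ⟨x, hx⟩ := (finite_termVar t).exists_notMem
  have h := Provable.subst_imp_ex (M := M) (F := eq (.var x) t) (s := t) ⟨trivial, ht⟩ x ht trivial
  have hsub (s : L.Term ℕ) : (eq (.var x) t).subst x s = eq s t := by
    simp only [subst, termSubst_of_notMem s hx]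
    simp [termSubst, Term.subst]
  rw [hsub] at h
  obtain ⟨y, -, hy⟩ := hT.witness x _ (hT.mp h (hT.mem_of_provable (.eq_refl ht)))
  rw [hsub] at hy
  exact ⟨y, hy⟩

/-- Two variables are equivalent if the Henkin set says that they are equal. -/
def setoid (hT : M.IsHenkin T) : Setoid ℕ where
  r x y := eqv x y ∈ T
  iseqv := ⟨fun x => hT.mem_of_provable (.eqRefl x), hT.eq_symm, hT.eq_trans⟩

/-- The domain of the model given by a Henkin set: as every term is equal to a variable, the
classes of the variables suffice. -/
def Model (hT : M.IsHenkin T) : Type := Quotient hT.setoid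

/-- The class of a variable. -/
def cls (hT : M.IsHenkin T) (x : ℕ) : hT.Model := Quotient.mk hT.setoid x

/-- A variable representing an element of the model. -/
noncomputable def rep (hT : M.IsHenkin T) (d : hT.Model) : ℕ := Quotient.out d

theorem cls_rep (hT : M.IsHenkin T) (d : hT.Model) : hT.cls (hT.rep d) = d := Quotient.out_eq d

theorem cls_eq_cls (hT : M.IsHenkin T) {x y : ℕ} : hT.cls x = hT.cls y ↔ eqv x y ∈ T :=
  Quotient.eq (r := hT.setoid)

open Classical in
/-- The value of a function at given classes is the class of any variable equal to the term; the
symbols which do not belong to the system get an arbitrary value. -/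
noncomputable instance (hT : M.IsHenkin T) : L.Structure hT.Model where
  funMap f ds := hT.cls (if h : ∃ y, eq (.var y) (.func f fun i => .var (hT.rep (ds i))) ∈ T
    then h.choose else 0)
  RelMap p ds := rel p (fun i => .var (hT.rep (ds i))) ∈ T

theorem realize_eq (hT : M.IsHenkin T) {t : L.Term ℕ} (ht : t ∈ M.terms) {y : ℕ}
    (hy : eq (.var y) t ∈ T) : t.realize hT.cls = hT.cls y := by
  induction t generalizing y with
  | var x => exact hT.cls_eq_cls.2 (hT.eq_symm hy)
  | func f ts ih =>
    choose ys hys using fun i => hT.exists_var_eq (ht.2 i)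
    have hr (i) : eq (ts i) (.var (hT.rep (hT.cls (ys i)))) ∈ T :=
      hT.eq_trans (hT.eq_symm (hys i)) (hT.cls_eq_cls.1 (hT.cls_rep _).symm)
    have h₁ := hT.mem_of_impChain (.eq_func ht.1 ht.2 fun i => M.var_mem_terms _) hr
    have h₂ : ∃ z, eq (.var z) (.func f fun i => .var (hT.rep (hT.cls (ys i)))) ∈ T :=
      ⟨y, hT.eq_trans hy h₁⟩
    simp only [Term.realize, fun i => ih i (ht.2 i) (hys i)]
    refine (congrArg hT.cls (dif_pos h₂)).trans (hT.cls_eq_cls.2 ?_)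
    exact hT.eq_trans (hT.eq_trans h₂.choose_spec (hT.eq_symm h₁)) (hT.eq_symm hy)

theorem sat_eq_iff (hT : M.IsHenkin T) {s t : L.Term ℕ} (hs : s ∈ M.terms) (ht : t ∈ M.terms) :
    (eq s t).Sat hT.cls ↔ eq s t ∈ T := by
  obtain ⟨y, hy⟩ := hT.exists_var_eq hs
  obtain ⟨z, hz⟩ := hT.exists_var_eq ht
  rw [Sat, hT.realize_eq hs hy, hT.realize_eq ht hz, hT.cls_eq_cls]
  exact ⟨fun h => hT.eq_trans (hT.eq_symm hy) (hT.eq_trans h hz),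
    fun h => hT.eq_trans hy (hT.eq_trans h (hT.eq_symm hz))⟩

theorem sat_rel_iff (hT : M.IsHenkin T) {n : ℕ} {p : L.Relations n} {ts : Fin n → L.Term ℕ}
    (h : rel p ts ∈ M.formulas) : (rel p ts).Sat hT.cls ↔ rel p ts ∈ T := by
  obtain ⟨hp, hts⟩ := h
  choose ys hys using fun i => hT.exists_var_eq (hts i)
  have hr (i) : eq (ts i) (.var (hT.rep (hT.cls (ys i)))) ∈ T :=
    hT.eq_trans (hT.eq_symm (hys i)) (hT.cls_eq_cls.1 (hT.cls_rep _).symm)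
  have hrf : rel p (fun i => Term.var (hT.rep (hT.cls (ys i)))) ∈ M.formulas :=
    ⟨hp, fun i => trivial⟩
  simp only [Sat, fun i => hT.realize_eq (hts i) (hys i)]
  change rel p _ ∈ T ↔ _
  constructor
  · exact (hT.imp_mem (G := rel p ts) hrf ⟨hp, hts⟩).1 (hT.mem_of_impChain
      (.eq_rel hp (fun i => M.var_mem_terms _) hts) fun i => hT.eq_symm (hr i))
  · exact (hT.imp_mem (F := rel p ts) ⟨hp, hts⟩ hrf).1 (hT.mem_of_impChain
      (.eq_rel hp hts fun i => M.var_mem_terms _) hr)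

/-- If an instance of an existential formula is true, then the formula belongs to the Henkin set.
The bound variables are renamed to make room for the variable naming the instance; the renamed
formula is equally true, by soundness of the calculus without basis axioms. -/
theorem ex_mem_of_sat (hT : M.IsHenkin T) {x : ℕ} {F : Form L} (hF : F ∈ M.formulas)
    (ih : ∀ G ∈ M.formulas, G.depth = F.depth → G.Sat hT.cls → G ∈ T)
    (h : (ex x F).Sat hT.cls) : ex x F ∈ T := by
  obtain ⟨d, hd⟩ := h
  obtain ⟨G, hdepth, hdisj, hprov⟩ :=
    exists_provable_iff_bound_disjoint F {hT.rep d} (Set.finite_singleton _)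
  have hG := (hprov M hF).mem_formulas.2
  rw [Set.disjoint_singleton_left] at hdisj
  have hcf := collisionFree_var (F := G) x hdisj
  have hsat : G.Sat (Function.update hT.cls x d) := by
    let M₀ : System L := ⟨M.A, M.P, ∅, by simp⟩
    exact ((hprov M₀ hF).sound (D := hT.Model) (fun _ h => (Set.notMem_empty _ h).elim) _).1 hd
  have hGT : G.subst x (.var (hT.rep d)) ∈ T := by
    refine ih _ (Over.subst hG x (M.var_mem_terms (hT.rep d))) ((depth_subst _ _ _).trans hdepth) ?_
    rw [sat_subst hcf]
    simpa [hT.cls_rep] using hsat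
  rw [hT.mem_iff_of_provable ((hprov M hF).ex_congr x)]
  exact hT.mp (.subst_imp_ex hG x (M.var_mem_terms _) hcf) hGT

/-- Truth in the term model is membership in the Henkin set. -/
theorem sat_iff_mem (hT : M.IsHenkin T) {F : Form L} (hF : F ∈ M.formulas) :
    F.Sat hT.cls ↔ F ∈ T := by
  induction hn : F.depth using Nat.strong_induction_on generalizing F with
  | _ n ih =>
  subst hn
  have ih' {G : Form L} (hG : G ∈ M.formulas) (h : G.depth < F.depth) : G.Sat hT.cls ↔ G ∈ T :=
    ih _ h hG rfl
  -- an existential formula in `T` is true because its witness is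
  have hex {x : ℕ} {G : Form L} (hG : G ∈ M.formulas) (h : ∀ H ∈ M.formulas, H.depth = G.depth →
      (H.Sat hT.cls ↔ H ∈ T)) : (ex x G).Sat hT.cls ↔ ex x G ∈ T := by
    refine ⟨hT.ex_mem_of_sat hG fun H hH hd => (h H hH hd).1, fun hex => ?_⟩
    obtain ⟨y, hyG, hy⟩ := hT.witness x G hex
    refine ⟨hT.cls y, ?_⟩
    have hsat := (h _ (Over.subst hG x (M.var_mem_terms y)) (depth_subst _ _ _)).2 hy
    rwa [sat_subst (collisionFree_var x fun hb => hyG (bound_subset_var G hb))] at hsat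
  cases F with
  | eq s t => exact hT.sat_eq_iff hF.1 hF.2
  | rel p ts => exact hT.sat_rel_iff hF
  | neg F => rw [Sat, ih' (G := F) hF (by simp [depth]), hT.neg_mem F hF]
  | imp F G =>
    rw [Sat, ih' hF.1 (by simp [depth]), ih' hF.2 (by simp [depth]),
      hT.imp_mem hF.1 hF.2]
  | and F G =>
    rw [Sat, ih' hF.1 (by simp [depth]), ih' hF.2 (by simp [depth]),
      hT.and_mem hF.1 hF.2]
  | or F G =>
    rw [Sat, ih' hF.1 (by simp [depth]), ih' hF.2 (by simp [depth]),
      hT.or_mem hF.1 hF.2]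
  | iff F G =>
    rw [Sat, ih' hF.1 (by simp [depth]), ih' hF.2 (by simp [depth]),
      hT.iff_mem hF.1 hF.2]
  | all x F =>
    have h₁ : (all x F).Sat hT.cls ↔ ¬ (ex x (neg F)).Sat hT.cls := by simp [Sat]
    have h₂ : M.Provable (iff (all x F) (neg (ex x (neg F)))) := by
      have h₃ : M.Provable (iff F (neg (neg F))) := .taut ⟨hF, hF⟩ fun τ => by simp [propTruth]
      refine .of_taut₂ (h₃.all_congr x) (.exIff x (F := neg F) hF) ⟨hF, hF⟩ fun τ => ?_
      simp only [propTruth]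
      tauto
    rw [h₁, hT.mem_iff_of_provable h₂, hT.neg_mem _ (by exact hF),
      hex (G := neg F) hF fun H hH hd => ih' hH (by simp [hd, depth])]
  | ex x F => exact hex hF fun H hH hd => ih' hH (by simp [hd, depth])

theorem models (hT : M.IsHenkin T) : M.Models hT.Model := by
  intro F hF ρ
  have closure (l : List ℕ) : M.Provable (l.foldr all F) := by
    induction l with
    | nil => exact .basis hF
    | cons x l ih => exact .gen x ih
  have sat (l : List ℕ) (ρ₀ : ℕ → hT.Model) (h : (l.foldr all F).Sat ρ₀) (ρ : ℕ → hT.Model)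
      (hρ : ∀ x ∉ l, ρ x = ρ₀ x) : F.Sat ρ := by
    induction l generalizing ρ₀ with
    | nil =>
      obtain rfl : ρ = ρ₀ := funext fun x => hρ x (by simp)
      exact h
    | cons x l ih =>
      refine ih _ (h (ρ x)) fun y hy => ?_
      by_cases hyx : y = x
      · subst hyx; simp
      · rw [Function.update_of_ne hyx]
        exact hρ y (by simp [hy, hyx])
  classical
  have h := closure F.finite_var.toFinset.toList
  refine (sat_congr (ρ' := fun x => if x ∈ F.var then ρ x else hT.cls x) fun x hx => ?_).2
    (sat _ hT.cls ((hT.sat_iff_mem h.mem_formulas).2 (hT.mem_of_provable h)) _ fun x hx => ?_)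
  · rw [if_pos (free_subset_var F hx)]
  · rw [if_neg (by simpa using hx)]

end IsHenkin

/-- Gödel's completeness theorem for systems with countably many symbols: a formula which holds in
all (countable) models is provable. -/
theorem provable_of_sat (hA : M.A.Countable) (hP : M.P.Countable) {F : Form L}
    (hF : F ∈ M.formulas)
    (h : ∀ (D : Type) [L.Structure D], M.Models D → ∀ ρ : ℕ → D, F.Sat ρ) : M.Provable F := by
  by_contra hc
  obtain ⟨T, hT, hFT⟩ := exists_isHenkin (countable_formulas hA hP) hF hc
  exact hFT ((hT.sat_iff_mem hF).1 (h hT.Model hT.models hT.cls))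

theorem Provable.mono {M' : System L} (hA : M.A ⊆ M'.A) (hP : M.P ⊆ M'.P) (hB : M.B ⊆ M'.B)
    (hform : M.formulas ⊆ M'.formulas) (hterm : M.terms ⊆ M'.terms)
    {F : Form L} (h : M.Provable F) : M'.Provable F := by
  induction h with
  | basis h => exact .basis (hB h)
  | taut h h' => exact .taut (hform h) h'
  | eqRefl x => exact .eqRefl x
  | eqEq => exact .eqEq _ _ _ _
  | eqFun f xs ys hf => exact .eqFun f xs ys (hA hf)
  | eqRel p xs ys hp => exact .eqRel p xs ys (hP hp)
  | allElim x h => exact .allElim x (hform h)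
  | allImp x h₁ h₂ hx => exact .allImp x (hform h₁) (hform h₂) hx
  | exIff x h => exact .exIff x (hform h)
  | mp _ _ ih₁ ih₂ => exact .mp ih₁ ih₂
  | subst x s _ hs hc ih => exact .subst x s ih (hterm hs) hc
  | gen x _ ih => exact .gen x ih

end System

end Completeness

end SetTh

namespace SetTh

open FirstOrder.Language (Term)
open Form

section Models

variable {L₀ : FirstOrder.Language.{u, v}}

/-! ### Set theory in the models of RST -/

/-- The membership relation of a structure. -/
def Mem (L₀ : FirstOrder.Language.{u, v}) {D : Type*} [(Sig L₀).Structure D] (a b : D) : Prop :=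
  FirstOrder.Language.Structure.RelMap (pr (L₀ := L₀) .mem) ![a, b]

variable {D : Type*} [(Sig L₀).Structure D]

theorem sat_rel₂ (p : (Sig L₀).Relations 2) (ts : Fin 2 → (Sig L₀).Term ℕ) (ρ : ℕ → D) :
    (rel p ts).Sat ρ ↔
      FirstOrder.Language.Structure.RelMap p ![(ts 0).realize ρ, (ts 1).realize ρ] := by
  rw [Sat]
  congr! 1
  funext i
  fin_cases i <;> rfl

theorem sat_mem (x y : ℕ) (ρ : ℕ → D) :
    (mem (L₀ := L₀) x y).Sat ρ ↔ Mem L₀ (ρ x) (ρ y) := by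
  rw [mem, sat_rel₂]
  rfl

theorem sat_eqv (x y : ℕ) (ρ : ℕ → D) :
    (eqv (L := Sig L₀) x y).Sat ρ ↔ ρ x = ρ y := Iff.rfl

/-- A property of assignments which is expressed by a formula of RST. -/
def Definable (L₀ : FirstOrder.Language.{u, v}) [(Sig L₀).Structure D] (p : (ℕ → D) → Prop) :
    Prop :=
  ∃ F : Form (Sig L₀), F.Over ∅ memSym ∧ ∀ ρ, F.Sat ρ ↔ p ρ

theorem over_mem {A : Set (Σ n, (Sig L₀).Functions n)} (x y : ℕ) :
    (mem (L₀ := L₀) x y).Over A memSym := by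
  simp [mem, Over, memSym, TermOver, Fin.forall_fin_two]

section RST

variable (hM : (systemRST L₀).Models D)
include hM

theorem eq_of_mem_iff {a b : D} (h : ∀ d, Mem L₀ d a ↔ Mem L₀ d b) : a = b := by
  have := hM _ (.ext 0 1 2 (by simp)) (Function.update (fun _ => a) 1 b)
  simp only [extensionality, Sat, sat_mem, sat_eqv] at this
  simpa using this (by simpa using h)

theorem eq_iff_of_mem_iff {a b : D} {q : D → Prop} (h : ∀ d, Mem L₀ d b ↔ q d) :
    a = b ↔ ∀ d, Mem L₀ d a ↔ q d := by
  refine ⟨?_, fun h' => eq_of_mem_iff hM fun d => (h' d).trans (h d).symm⟩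
  rintro rfl
  exact h

/-- Subset axioms hold for all definable properties: as the axioms concern formulas in which two
of the variables do not occur, they are applied to variables which are new to the formula. -/
theorem exists_mem_iff_and {p : (ℕ → D) → Prop} (hp : Definable L₀ p) (ρ : ℕ → D) (y : ℕ) (a : D) :
    ∃ b, ∀ d, Mem L₀ d b ↔ Mem L₀ d a ∧ p (Function.update ρ y d) := by
  obtain ⟨F, hF, hFp⟩ := hp
  obtain ⟨u, hu⟩ := (F.finite_var.insert y).exists_notMem
  obtain ⟨x, hx⟩ := ((F.finite_var.insert y).insert u).exists_notMem
  simp only [Set.mem_insert_iff, not_or] at hu hx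
  obtain ⟨huy, huF⟩ := hu
  obtain ⟨hxu, hxy, hxF⟩ := hx
  obtain ⟨b, hb⟩ := hM _ (.sep x y u F (by simp [hxy, hxu, Ne.symm huy]) hF huF hxF)
    (Function.update ρ x a)
  refine ⟨b, fun d => ?_⟩
  have := hb d
  simp only [Sat, sat_mem] at this
  rw [Function.update_self, Function.update_of_ne huy, Function.update_self,
    Function.update_of_ne hxy, Function.update_of_ne hxu, Function.update_self] at this
  rw [this, ← hFp]
  refine and_congr_right fun _ => sat_congr fun z hz => ?_
  have hzF := free_subset_var F hz
  have hzu : z ≠ u := by rintro rfl; exact huF hzF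
  have hzx : z ≠ x := by rintro rfl; exact hxF hzF
  by_cases hzy : z = y
  · subst hzy; simp
  · simp [hzy, hzu, hzx]

theorem sat_separation {F : Form (Sig L₀)} (hF : Definable L₀ fun ρ : ℕ → D => F.Sat ρ)
    {x y u : ℕ} (h : [x, y, u].Nodup) (hu : u ∉ F.free) (ρ : ℕ → D) :
    (separation x y u F).Sat ρ := by
  simp only [List.nodup_cons, List.mem_cons, List.not_mem_nil, or_false, not_or] at h
  obtain ⟨⟨hxy, hxu⟩, hyu, -⟩ := h
  obtain ⟨b, hb⟩ := exists_mem_iff_and hM hF ρ y (ρ x)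
  refine ⟨b, fun d => ?_⟩
  simp only [Sat, sat_mem]
  rw [Function.update_self, Function.update_of_ne (Ne.symm hyu), Function.update_self,
    Function.update_of_ne hxy, Function.update_of_ne hxu, hb, Function.update_comm (Ne.symm hyu)]
  exact and_congr_right fun _ => (sat_update_of_notMem_free hu _ _).symm

theorem exists_empty (a : D) : ∃ b : D, ∀ d, ¬ Mem L₀ d b := by
  obtain ⟨b, hb⟩ := exists_mem_iff_and hM (p := fun ρ => ¬ Mem L₀ (ρ 0) (ρ 1))
    ⟨neg (mem 0 1), over_mem _ _, fun ρ => by simp only [Sat, sat_mem]⟩ (fun _ => a) 0 a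
  refine ⟨b, fun d hd => ?_⟩
  have := (hb d).1 hd
  simp at this

/-- Every set belongs to a transitive set which with each member has its power set as a member,
and any two members of which belong to a transitive member. -/
theorem exists_subsetFriendly (a : D) : ∃ u : D, Mem L₀ a u ∧
    (∀ y, Mem L₀ y u → ∀ z, Mem L₀ z y → Mem L₀ z u) ∧
    (∀ y, Mem L₀ y u → ∃ z, Mem L₀ z u ∧
      ∀ v, Mem L₀ v z ↔ ∀ w, Mem L₀ w v → Mem L₀ w y) ∧
    ∀ y, Mem L₀ y u → ∀ z, Mem L₀ z u → ∃ v, (Mem L₀ v u ∧ Mem L₀ y v ∧ Mem L₀ z v) ∧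
      ∀ w, Mem L₀ w v → ∀ t, Mem L₀ t w → Mem L₀ t v := by
  have := hM _ (.sf 0 1 2 3 4 5 6 (by simp)) (fun _ => a)
  simp only [subsetFriendly, Sat, sat_mem] at this
  simpa [and_assoc] using this

theorem exists_union (a : D) : ∃ b : D, ∀ d, Mem L₀ d b ↔ ∃ c, Mem L₀ d c ∧ Mem L₀ c a := by
  obtain ⟨u, hau, htrans, -⟩ := exists_subsetFriendly hM a
  obtain ⟨b, hb⟩ := exists_mem_iff_and hM
    (p := fun ρ => ∃ c, Mem L₀ (ρ 0) c ∧ Mem L₀ c (ρ 1))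
    ⟨ex 2 (and (mem 0 2) (mem 2 1)), ⟨over_mem _ _, over_mem _ _⟩, fun ρ => by
      simp [Sat, sat_mem]⟩ (fun _ => a) 0 u
  refine ⟨b, fun d => ?_⟩
  rw [hb]
  simp only [Function.update_self, ne_eq, one_ne_zero, not_false_eq_true, Function.update_of_ne,
    and_iff_right_iff_imp]
  rintro ⟨c, hdc, hca⟩
  exact htrans c (htrans a hau c hca) d hdc

theorem exists_pair (a b : D) : ∃ c : D, ∀ d, Mem L₀ d c ↔ d = a ∨ d = b := by
  obtain ⟨u, hu⟩ := hM _ (.pair 0 1 2 (by simp)) (Function.update (fun _ => a) 1 b)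
  simp only [Sat, sat_mem] at hu
  obtain ⟨hau, hbu⟩ : Mem L₀ a u ∧ Mem L₀ b u := by simpa using hu
  obtain ⟨c, hc⟩ := exists_mem_iff_and hM
    (p := fun ρ => ρ 0 = ρ 1 ∨ ρ 0 = ρ 2)
    ⟨or (eqv 0 1) (eqv 0 2), by simp [Over, eqv, TermOver], fun ρ => by
      simp only [Sat, sat_eqv]⟩ (Function.update (fun _ => a) 2 b) 0 u
  refine ⟨c, fun d => ?_⟩
  rw [hc]
  simp only [Function.update_self, ne_eq, one_ne_zero, not_false_eq_true, Function.update_of_ne,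
    OfNat.ofNat_ne_zero, OfNat.one_ne_ofNat, and_iff_right_iff_imp]
  rintro (rfl | rfl) <;> assumption

theorem exists_powerset (a : D) :
    ∃ b : D, ∀ d, Mem L₀ d b ↔ ∀ w, Mem L₀ w d → Mem L₀ w a := by
  obtain ⟨u, hau, -, hpow, -⟩ := exists_subsetFriendly hM a
  obtain ⟨b, -, hb⟩ := hpow a hau
  exact ⟨b, hb⟩

/-- A subset-friendly set containing the empty set is inductive: if `y` belongs to the transitive
member `v`, then `y ∪ {y}` is a subset of `v`, and so a member of its power set. -/
theorem exists_inductive (a : D) : ∃ u : D, (∃ y, Mem L₀ y u ∧ ∀ z, ¬ Mem L₀ z y) ∧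
    ∀ y, Mem L₀ y u → ∃ z, Mem L₀ z u ∧ ∀ v, Mem L₀ v z ↔ Mem L₀ v y ∨ v = y := by
  obtain ⟨e, he⟩ := exists_empty hM a
  obtain ⟨u, heu, htrans, hpow, hdir⟩ := exists_subsetFriendly hM e
  refine ⟨u, ⟨e, heu, he⟩, fun y hy => ?_⟩
  obtain ⟨v, ⟨hvu, hyv, -⟩, hv⟩ := hdir y hy y hy
  obtain ⟨p, hpu, hp⟩ := hpow v hvu
  obtain ⟨z, hz⟩ := exists_mem_iff_and hM (p := fun ρ => Mem L₀ (ρ 0) (ρ 1) ∨ ρ 0 = ρ 1)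
    ⟨or (mem 0 1) (eqv 0 1), ⟨over_mem _ _, by simp [Over, eqv, TermOver]⟩, fun ρ => by
      simp only [Sat, sat_eqv, sat_mem]⟩ (fun _ => y) 0 v
  simp only [Function.update_self, ne_eq, one_ne_zero, not_false_eq_true, Function.update_of_ne]
    at hz
  refine ⟨z, htrans p hpu z ((hp z).2 fun w hw => ((hz w).1 hw).1), fun w => ?_⟩
  rw [hz, and_iff_right_iff_imp]
  rintro (h | rfl)
  · exact hv y hyv w h
  · exact hyv

end RST

end Models

section RSTProvable

/-! ### Theorems of RST -/

variable {L₀ : FirstOrder.Language.{u, v}}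

theorem rst_provable {F : Form (Sig L₀)} (hF : F.Over ∅ memSym)
    (h : ∀ (D : Type) [(Sig L₀).Structure D], (systemRST L₀).Models D → ∀ ρ : ℕ → D, F.Sat ρ) :
    F ∈ (systemRST L₀).provables :=
  System.provable_of_sat Set.countable_empty (Set.countable_singleton _) hF h

theorem rst_separation {x y u : ℕ} {F : Form (Sig L₀)} (h : [x, y, u].Nodup)
    (hF : F.Over ∅ memSym) (hu : u ∉ F.free) :
    separation x y u F ∈ (systemRST L₀).provables :=
  rst_provable ⟨over_mem _ _, over_mem _ _, hF⟩ fun _ _ hM ρ =>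
    sat_separation hM ⟨F, hF, fun _ => Iff.rfl⟩ h hu ρ

theorem rst_emptySetExists {u y : ℕ} (h : [u, y].Nodup) :
    emptySetExists u y ∈ (systemRST L₀).provables := by
  refine rst_provable (over_mem _ _) fun D _ hM ρ => ?_
  simp only [List.nodup_cons, List.mem_cons, List.not_mem_nil, or_false] at h
  simpa [emptySetExists, Sat, sat_mem, h, Ne.symm h.1] using exists_empty hM (ρ 0)

theorem rst_unionExists {x y z u : ℕ} (h : [x, y, z, u].Nodup) :
    unionExists x y z u ∈ (systemRST L₀).provables := by
  refine rst_provable ⟨over_mem _ _, over_mem _ _, over_mem _ _⟩ fun D _ hM ρ => ?_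
  simp only [List.nodup_cons, List.mem_cons, List.not_mem_nil, or_false, not_or] at h
  obtain ⟨⟨hxy, hxz, hxu⟩, ⟨hyz, hyu⟩, hzu, -⟩ := h
  simpa [unionExists, Sat, sat_mem, hxy, hxz, hxu, Ne.symm hyz, Ne.symm hyu, Ne.symm hzu]
    using exists_union hM (ρ x)

theorem rst_pairSetExists {x y z u : ℕ} (h : [x, y, z, u].Nodup) :
    pairSetExists x y z u ∈ (systemRST L₀).provables := by
  refine rst_provable ⟨over_mem _ _, by simp [eqv, Over, TermOver]⟩ fun D _ hM ρ => ?_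
  simp only [List.nodup_cons, List.mem_cons, List.not_mem_nil, or_false, not_or] at h
  obtain ⟨⟨hxy, hxz, hxu⟩, ⟨hyz, hyu⟩, hzu, -⟩ := h
  simpa [pairSetExists, Sat, sat_mem, sat_eqv, hxz, hxu, hyz, hyu, Ne.symm hzu]
    using exists_pair hM (ρ x) (ρ y)

theorem rst_powerSetExists {x z v w : ℕ} (h : [x, z, v, w].Nodup) :
    powerSetExists x z v w ∈ (systemRST L₀).provables := by
  refine rst_provable ⟨over_mem _ _, over_mem _ _, over_mem _ _⟩ fun D _ hM ρ => ?_
  simp only [List.nodup_cons, List.mem_cons, List.not_mem_nil, or_false, not_or] at h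
  obtain ⟨⟨hxz, hxv, hxw⟩, ⟨hzv, hzw⟩, hvw, -⟩ := h
  simpa [powerSetExists, Sat, sat_mem, hxz, hxv, hxw, hzv, hvw]
    using exists_powerset hM (ρ x)

theorem rst_inductiveSetExists {x y z v : ℕ} (h : [x, y, z, v].Nodup) :
    inductiveSetExists x y z v ∈ (systemRST L₀).provables := by
  refine rst_provable ⟨⟨over_mem _ _, over_mem _ _⟩, over_mem _ _, over_mem _ _, over_mem _ _,
    over_mem _ _, by simp [eqv, Over, TermOver]⟩ fun D _ hM ρ => ?_
  simp only [List.nodup_cons, List.mem_cons, List.not_mem_nil, or_false, not_or] at h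
  obtain ⟨⟨hxy, hxz, hxv⟩, ⟨hyz, hyv⟩, hzv, -⟩ := h
  simpa [inductiveSetExists, Sat, sat_mem, sat_eqv, hxy, hxz, hxv, hyz, hyv, hzv]
    using exists_inductive hM (ρ 0)

theorem rst_zfc {F : Form (Sig L₀)} (h : ZFCWithoutReplacement F) :
    F ∈ (systemRST L₀).provables := by
  cases h with
  | ext u v y h => exact .basis (.ext u v y h)
  | sep x y u F h hF hu => exact rst_separation h hF hu
  | reg u y z h => exact .basis (.reg u y z h)
  | empty u y h => exact rst_emptySetExists h
  | union x y z u h => exact rst_unionExists h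
  | pair x y z u h => exact rst_pairSetExists h
  | pow x z v w h => exact rst_powerSetExists h
  | inf x y z v h => exact rst_inductiveSetExists h
  | ac u v w x y h => exact .basis (.ac u v w x y h)

end RSTProvable

end SetTh

namespace SetTh

open FirstOrder.Language (Term)
open Form

section Elimination

variable {L₀ : FirstOrder.Language.{u, v}} {D : Type*} [(Sig L₀).Structure D]

/-! ### Elimination of the defined symbols -/

namespace Definable

variable {p q : (ℕ → D) → Prop}

theorem congr (hp : Definable L₀ p) (h : ∀ ρ, p ρ ↔ q ρ) : Definable L₀ q := by
  obtain ⟨F, hF, hFp⟩ := hp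
  exact ⟨F, hF, fun ρ => (hFp ρ).trans (h ρ)⟩

theorem mem (x y : ℕ) : Definable L₀ fun ρ : ℕ → D => Mem L₀ (ρ x) (ρ y) :=
  ⟨_, over_mem x y, sat_mem x y⟩

theorem eqv (x y : ℕ) : Definable L₀ fun ρ : ℕ → D => ρ x = ρ y :=
  ⟨.eqv x y, ⟨trivial, trivial⟩, sat_eqv x y⟩

theorem neg (hp : Definable L₀ p) : Definable L₀ fun ρ => ¬ p ρ := by
  obtain ⟨F, hF, hFp⟩ := hp
  exact ⟨.neg F, hF, fun ρ => not_congr (hFp ρ)⟩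

theorem imp (hp : Definable L₀ p) (hq : Definable L₀ q) : Definable L₀ fun ρ => p ρ → q ρ := by
  obtain ⟨F, hF, hFp⟩ := hp
  obtain ⟨G, hG, hGq⟩ := hq
  exact ⟨.imp F G, ⟨hF, hG⟩, fun ρ => imp_congr (hFp ρ) (hGq ρ)⟩

theorem and (hp : Definable L₀ p) (hq : Definable L₀ q) : Definable L₀ fun ρ => p ρ ∧ q ρ := by
  obtain ⟨F, hF, hFp⟩ := hp
  obtain ⟨G, hG, hGq⟩ := hq
  exact ⟨.and F G, ⟨hF, hG⟩, fun ρ => and_congr (hFp ρ) (hGq ρ)⟩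

theorem or (hp : Definable L₀ p) (hq : Definable L₀ q) : Definable L₀ fun ρ => p ρ ∨ q ρ := by
  obtain ⟨F, hF, hFp⟩ := hp
  obtain ⟨G, hG, hGq⟩ := hq
  exact ⟨.or F G, ⟨hF, hG⟩, fun ρ => or_congr (hFp ρ) (hGq ρ)⟩

theorem iff (hp : Definable L₀ p) (hq : Definable L₀ q) : Definable L₀ fun ρ => p ρ ↔ q ρ := by
  obtain ⟨F, hF, hFp⟩ := hp
  obtain ⟨G, hG, hGq⟩ := hq
  exact ⟨.iff F G, ⟨hF, hG⟩, fun ρ => iff_congr (hFp ρ) (hGq ρ)⟩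

theorem all (x : ℕ) (hp : Definable L₀ p) :
    Definable L₀ fun ρ => ∀ d, p (Function.update ρ x d) := by
  obtain ⟨F, hF, hFp⟩ := hp
  exact ⟨.all x F, hF, fun ρ => forall_congr' fun d => hFp _⟩

theorem ex (x : ℕ) (hp : Definable L₀ p) :
    Definable L₀ fun ρ => ∃ d, p (Function.update ρ x d) := by
  obtain ⟨F, hF, hFp⟩ := hp
  exact ⟨.ex x F, hF, fun ρ => exists_congr fun d => hFp _⟩

/-- If the graph of the value of a term is definable, the term may be substituted for a variable of
a definable property. -/
theorem comp (hp : Definable L₀ p) {t : (Sig L₀).Term ℕ}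
    (ht : ∀ y, Definable L₀ fun ρ : ℕ → D => ρ y = t.realize ρ) {z : ℕ} (hz : z ∉ termVar t) :
    Definable L₀ fun ρ => p (Function.update ρ z (t.realize ρ)) := by
  refine (((ht z).and hp).ex z).congr fun ρ => ?_
  have h (d : D) : t.realize (Function.update ρ z d) = t.realize ρ :=
    realize_congr t fun x hx => Function.update_of_ne (by rintro rfl; exact hz hx) _ _
  simp [h]

theorem comp₂ {g : D → D → D → Prop} {s t : (Sig L₀).Term ℕ} (y : ℕ)
    (hg : ∀ z w, z ≠ y → w ≠ y → w ≠ z → Definable L₀ fun ρ : ℕ → D => g (ρ y) (ρ z) (ρ w))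
    (hs : ∀ y, Definable L₀ fun ρ : ℕ → D => ρ y = s.realize ρ)
    (ht : ∀ y, Definable L₀ fun ρ : ℕ → D => ρ y = t.realize ρ) :
    Definable L₀ fun ρ : ℕ → D => g (ρ y) (s.realize ρ) (t.realize ρ) := by
  obtain ⟨z, hz⟩ := ((finite_termVar s).insert y).exists_notMem
  obtain ⟨w, hw⟩ :=
    ((((finite_termVar s).union (finite_termVar t)).insert z).insert y).exists_notMem
  simp only [Set.mem_insert_iff, Set.mem_union, not_or] at hz hw
  obtain ⟨hzy, hzs⟩ := hz
  obtain ⟨hwy, hwz, hws, hwt⟩ := hw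
  refine (((hg z w hzy hwy hwz).comp hs hzs).comp ht hwt).congr fun ρ => ?_
  have h (d : D) : s.realize (Function.update ρ w d) = s.realize ρ :=
    realize_congr s fun x hx => Function.update_of_ne (by rintro rfl; exact hws hx) _ _
  simp [h, Ne.symm hzy, Ne.symm hwy, hwz]

end Definable

theorem realize_func₁ (f : (Sig L₀).Functions 1) (ts : Fin 1 → (Sig L₀).Term ℕ) (ρ : ℕ → D) :
    (Term.func f ts).realize ρ =
      FirstOrder.Language.Structure.funMap f ![(ts 0).realize ρ] := by
  rw [Term.realize]
  congr! 1
  funext i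
  fin_cases i
  rfl

theorem realize_func₂ (f : (Sig L₀).Functions 2) (ts : Fin 2 → (Sig L₀).Term ℕ) (ρ : ℕ → D) :
    (Term.func f ts).realize ρ =
      FirstOrder.Language.Structure.funMap f ![(ts 0).realize ρ, (ts 1).realize ρ] := by
  rw [Term.realize]
  congr! 1
  funext i
  fin_cases i <;> rfl

theorem realize_func₀ (f : (Sig L₀).Functions 0) (ts : Fin 0 → (Sig L₀).Term ℕ) (ρ : ℕ → D) :
    (Term.func f ts).realize ρ = FirstOrder.Language.Structure.funMap f ![] := by
  rw [Term.realize]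
  congr! 1

theorem models_rst_of_models_rstext (hM : (systemRSText L₀).Models D) :
    (systemRST L₀).Models D :=
  fun F hF => hM F (Or.inl hF)

/-- In the models of RST_ext, the graphs of the values of terms are definable without the defined
function symbols, by the defining axioms of these symbols. -/
theorem definable_eq_realize (hM : (systemRSText L₀).Models D) {t : (Sig L₀).Term ℕ}
    (ht : t ∈ (systemRSText L₀).terms) (y : ℕ) :
    Definable L₀ fun ρ : ℕ → D => ρ y = t.realize ρ := by
  have def_axiom {F G : Form (Sig L₀)} (h : BasisDef (.iff F G)) (hG : G.Over ∅ memSym) :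
      Definable L₀ fun ρ : ℕ → D => F.Sat ρ :=
    ⟨G, hG, fun ρ => (hM _ (Or.inr h) ρ).symm⟩
  induction t generalizing y with
  | var x => exact .eqv y x
  | @func n f ts ih =>
    obtain ⟨hf, hts⟩ := ht
    have ih' := fun i y => ih i (hts i) y
    clear ih
    obtain ⟨a, ha⟩ := (Set.finite_singleton y).exists_notMem
    rw [Set.mem_singleton_iff] at ha
    simp only [systemRSText, Set.mem_insert_iff, Set.mem_singleton_iff] at hf
    rcases hf with hf | hf | hf | hf | hf <;> cases hf
    · refine (def_axiom (.empty y a (by simp [Ne.symm ha])) (over_mem _ _)).congr fun ρ => ?_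
      simp only [Sat, realize_func₀, Term.realize_var]
    · simp only [realize_func₁]
      refine Definable.comp₂ (g := fun y a _ => y = FirstOrder.Language.Structure.funMap _ ![a]) y
        (fun z w hz hw hwz => ?_) (ih' 0) (ih' 0)
      obtain ⟨x, hx⟩ := (Set.toFinite {y, z, w}).exists_notMem
      simp only [Set.mem_insert_iff, Set.mem_singleton_iff, not_or] at hx
      refine (def_axiom (.union y z w x (by simp; tauto))
        ⟨over_mem _ _, over_mem _ _, over_mem _ _⟩).congr fun ρ => ?_
      rw [Sat, realize_func₁]
      rfl
    · simp only [realize_func₁]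
      refine Definable.comp₂ (g := fun y a _ => y = FirstOrder.Language.Structure.funMap _ ![a]) y
        (fun z w hz hw hwz => ?_) (ih' 0) (ih' 0)
      refine (def_axiom (.sing y z w (by simp; tauto))
        ⟨over_mem _ _, trivial, trivial⟩).congr fun ρ => ?_
      rw [Sat, realize_func₁]
      rfl
    · simp only [realize_func₂]
      refine Definable.comp₂
        (g := fun y a b => y = FirstOrder.Language.Structure.funMap _ ![a, b]) y
        (fun z w hz hw hwz => ?_) (ih' 0) (ih' 1)
      obtain ⟨x, hx⟩ := (Set.toFinite {y, z, w}).exists_notMem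
      simp only [Set.mem_insert_iff, Set.mem_singleton_iff, not_or] at hx
      refine (def_axiom (.pair y z w x (by simp; tauto))
        ⟨over_mem _ _, ⟨trivial, trivial⟩, trivial, trivial⟩).congr fun ρ => ?_
      rw [Sat, realize_func₂]
      rfl
    · simp only [realize_func₁]
      refine Definable.comp₂ (g := fun y a _ => y = FirstOrder.Language.Structure.funMap _ ![a]) y
        (fun z w hz hw hwz => ?_) (ih' 0) (ih' 0)
      obtain ⟨x, hx⟩ := (Set.toFinite {y, z, w}).exists_notMem
      simp only [Set.mem_insert_iff, Set.mem_singleton_iff, not_or] at hx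
      refine (def_axiom (.pow w x z y (by simp; tauto))
        ⟨over_mem _ _, over_mem _ _, over_mem _ _⟩).congr fun ρ => ?_
      rw [Sat, realize_func₁]
      rfl

theorem definable_sat (hM : (systemRSText L₀).Models D) {F : Form (Sig L₀)}
    (hF : F ∈ (systemRSText L₀).formulas) : Definable L₀ fun ρ : ℕ → D => F.Sat ρ := by
  induction F with
  | eq s t =>
    exact Definable.comp₂ (g := fun _ a b => a = b) 0 (fun z w _ _ _ => .eqv z w)
      (definable_eq_realize hM hF.1) (definable_eq_realize hM hF.2)
  | @rel n p ts =>
    obtain ⟨hp, hts⟩ := hF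
    simp only [systemRSText, Set.mem_insert_iff, Set.mem_singleton_iff] at hp
    rcases hp with hp | hp <;> cases hp <;> simp only [sat_rel₂]
    · exact Definable.comp₂ (g := fun _ a b => Mem L₀ a b) 0 (fun z w _ _ _ => .mem z w)
        (definable_eq_realize hM (hts 0)) (definable_eq_realize hM (hts 1))
    · refine Definable.comp₂
        (g := fun _ a b => FirstOrder.Language.Structure.RelMap (pr (L₀ := L₀) .sub) ![a, b]) 0
        (fun z w _ _ hwz => ?_)
        (definable_eq_realize hM (hts 0)) (definable_eq_realize hM (hts 1))
      obtain ⟨x, hx⟩ := (Set.toFinite {z, w}).exists_notMem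
      simp only [Set.mem_insert_iff, Set.mem_singleton_iff, not_or] at hx
      refine ⟨.all x (.imp (mem x z) (mem x w)), ⟨over_mem _ _, over_mem _ _⟩, fun ρ =>
        (hM _ (Or.inr (.subset z w x (by simp; tauto))) ρ).symm.trans ?_⟩
      rw [sub, sat_rel₂]
      rfl
  | neg F ih => exact (ih hF).neg
  | imp F G ih₁ ih₂ => exact (ih₁ hF.1).imp (ih₂ hF.2)
  | and F G ih₁ ih₂ => exact (ih₁ hF.1).and (ih₂ hF.2)
  | or F G ih₁ ih₂ => exact (ih₁ hF.1).or (ih₂ hF.2)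
  | iff F G ih₁ ih₂ => exact (ih₁ hF.1).iff (ih₂ hF.2)
  | all x F ih => exact (ih hF).all x
  | ex x F ih => exact (ih hF).ex x

end Elimination

section Expansion

variable {L₀ : FirstOrder.Language.{u, v}} {D : Type*}

/-! ### Expansion of the models of RST to models of RST_ext -/

/-- The truth of a formula of RST depends only on the interpretation of the membership symbol. -/
theorem sat_iff_of_mem_iff (S S' : (Sig L₀).Structure D)
    (h : ∀ a b, @Mem L₀ D S a b ↔ @Mem L₀ D S' a b) {F : Form (Sig L₀)}
    (hF : F.Over ∅ memSym) (ρ : ℕ → D) :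
    @Form.Sat _ D S ρ F ↔ @Form.Sat _ D S' ρ F := by
  have hterm {t : (Sig L₀).Term ℕ} (ht : TermOver ∅ t) (ρ : ℕ → D) :
      @Term.realize _ D S _ ρ t = @Term.realize _ D S' _ ρ t := by
    cases t with
    | var x => rfl
    | func f ts => exact (Set.notMem_empty _ ht.1).elim
  induction F generalizing ρ with
  | eq s t => simp only [Sat, hterm hF.1, hterm hF.2]
  | @rel n p ts =>
    obtain ⟨hp, hts⟩ := hF
    cases hp
    rw [@sat_rel₂ _ D S, @sat_rel₂ _ D S', hterm (hts 0), hterm (hts 1)]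
    exact h _ _
  | neg F ih => simp only [Sat, ih hF]
  | imp F G ih₁ ih₂ | and F G ih₁ ih₂ | or F G ih₁ ih₂ | iff F G ih₁ ih₂ =>
    simp only [Sat, ih₁ hF.1, ih₂ hF.2]
  | all x F ih | ex x F ih => simp only [Sat, ih hF]

/-- Given values of the defined functions, and inclusion as the relation `⊆`, a structure with the
same membership relation and the same interpretation of the further symbols. -/
abbrev expansion (S : (Sig L₀).Structure D) (e : D) (un si po : D → D) (pa : D → D → D) :
    (Sig L₀).Structure D where
  funMap
    | .inl .empty, _ => e
    | .inl .union, ds => un (ds 0)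
    | .inl .sing, ds => si (ds 0)
    | .inl .pair, ds => pa (ds 0) (ds 1)
    | .inl .pow, ds => po (ds 0)
    | .inr f, ds => S.funMap (Sum.inr f) ds
  RelMap
    | .inl .mem, ds => S.RelMap (pr .mem) ds
    | .inl .sub, ds => ∀ d, @Mem L₀ D S d (ds 0) → @Mem L₀ D S d (ds 1)
    | .inr p, ds => S.RelMap (Sum.inr p) ds

/-- Every model of RST has an expansion to a model of RST_ext. -/
theorem exists_models_rstext [S : (Sig L₀).Structure D] [Nonempty D]
    (hM : (systemRST L₀).Models D) : ∃ S' : (Sig L₀).Structure D,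
      (∀ a b, @Mem L₀ D S a b ↔ @Mem L₀ D S' a b) ∧ @System.Models _ (systemRSText L₀) D S' := by
  obtain ⟨e, he⟩ := exists_empty hM (Classical.arbitrary D)
  choose un hun using exists_union hM
  choose po hpo using exists_powerset hM
  choose pa hpa using exists_pair hM
  have key {a b : D} {q : D → Prop} (h : ∀ d, Mem L₀ d b ↔ q d) :
      a = b ↔ ∀ d, Mem L₀ d a ↔ q d := eq_iff_of_mem_iff hM h
  have key₀ {a : D} : a = e ↔ ∀ d, ¬ Mem L₀ d a := by
    simpa using key (a := a) (q := fun _ => False) (by simpa using he)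
  let S' := expansion S e un (fun a => pa a a) po pa
  have hmem (a b : D) : @Mem L₀ D S a b ↔ @Mem L₀ D S' a b := Iff.rfl
  refine ⟨S', hmem, fun F hF ρ => ?_⟩
  rcases hF with hF | hF
  · exact (sat_iff_of_mem_iff S S' hmem hF.isOver ρ).1 (hM F hF ρ)
  cases hF with
  | empty u y h =>
    simp only [List.nodup_cons, List.mem_cons, List.not_mem_nil, or_false] at h
    simp only [Sat, sat_mem, Function.update_self, Function.update_of_ne h.1]
    exact key₀
  | subset u v y h =>
    simp only [List.nodup_cons, List.mem_cons, List.not_mem_nil, or_false, not_or] at h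
    obtain ⟨⟨huv, huy⟩, hvy, -⟩ := h
    rw [Sat, sub, sat_rel₂]
    simp only [Sat, sat_mem, Function.update_self, Function.update_of_ne huy,
      Function.update_of_ne hvy]
    rfl
  | union u x y z h =>
    simp only [List.nodup_cons, List.mem_cons, List.not_mem_nil, or_false, not_or] at h
    obtain ⟨⟨hux, huy, huz⟩, ⟨hxy, hxz⟩, hyz, -⟩ := h
    simp only [Sat, sat_mem, Function.update_self, Function.update_of_ne huz,
      Function.update_of_ne hxy, Function.update_of_ne hxz, Function.update_of_ne (Ne.symm hyz)]
    exact key (hun (ρ x))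
  | sing u x y h =>
    simp only [List.nodup_cons, List.mem_cons, List.not_mem_nil, or_false, not_or] at h
    obtain ⟨⟨hux, huy⟩, hxy, -⟩ := h
    simp only [Sat, sat_mem, sat_eqv, Function.update_self, Function.update_of_ne huy,
      Function.update_of_ne hxy]
    exact key fun d => (hpa (ρ x) (ρ x) d).trans (or_self_iff)
  | pair u x y z h =>
    simp only [List.nodup_cons, List.mem_cons, List.not_mem_nil, or_false, not_or] at h
    obtain ⟨⟨hux, huy, huz⟩, ⟨hxy, hxz⟩, hyz, -⟩ := h
    simp only [Sat, sat_mem, sat_eqv, Function.update_self, Function.update_of_ne huz,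
      Function.update_of_ne hxz, Function.update_of_ne hyz]
    exact key (hpa (ρ x) (ρ y))
  | pow v w x z h =>
    simp only [List.nodup_cons, List.mem_cons, List.not_mem_nil, or_false, not_or] at h
    obtain ⟨⟨hvw, hvx, hvz⟩, ⟨hwx, hwz⟩, hxz, -⟩ := h
    simp only [Sat, sat_mem, Function.update_self, Function.update_of_ne (Ne.symm hvz),
      Function.update_of_ne (Ne.symm hvx), Function.update_of_ne (Ne.symm hwx),
      Function.update_of_ne hvw]
    exact key (hpo (ρ x))

end Expansion

section Systems

/-! ### RST_ext as an extension of RST -/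

variable (L₀ : FirstOrder.Language.{u, v})

theorem rst_isExtension_rstext : (systemRST L₀).IsExtension (systemRSText L₀) := by
  have hA : (systemRST L₀).A ⊆ (systemRSText L₀).A := Set.empty_subset _
  have hP : (systemRST L₀).P ⊆ (systemRSText L₀).P := by simp [systemRST, systemRSText, memSym]
  have hterm : (systemRST L₀).terms ⊆ (systemRSText L₀).terms := fun t => TermOver.mono hA t
  exact ⟨hA, hP, hterm, fun F hF => System.Provable.mono hA hP (fun F => Or.inl)
    (fun F hF => hF.mono hA hP) hterm hF⟩

theorem rstext_isSubsetFriendly : IsSubsetFriendly (systemRSText L₀) := by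
  have hP : (systemRSText L₀).P.Countable := (Set.toFinite {_, _}).countable
  have hA : (systemRSText L₀).A.Countable := (Set.toFinite {_, _, _, _, _}).countable
  refine ⟨rst_isExtension_rstext L₀, fun x y u F h hF hu _ =>
    System.provable_of_sat hA hP ?_ fun D _ hM ρ => ?_⟩
  · have hmem (x y : ℕ) : mem x y ∈ (systemRSText L₀).formulas :=
      (over_mem x y).mono subset_rfl (by simp [systemRSText, memSym])
    exact ⟨hmem _ _, hmem _ _, hF⟩
  · exact sat_separation (models_rst_of_models_rstext hM) (definable_sat hM hF) h
      (fun h => hu (free_subset_var F h)) ρ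

/-- By soundness, a formula of RST provable in RST_ext holds in the models of RST which expand to
models of RST_ext, that is, in all of them; by completeness, it is provable in RST. -/
theorem rstext_isConservativeExtension :
    (systemRST L₀).IsConservativeExtension (systemRSText L₀) := by
  refine ⟨rst_isExtension_rstext L₀, fun F hF hprov => rst_provable hF fun D S hM ρ => ?_⟩
  have : Nonempty D := ⟨ρ 0⟩
  obtain ⟨S', hmem, hM'⟩ := exists_models_rstext hM
  exact (sat_iff_of_mem_iff S S' hmem hF ρ).2 (@System.Provable.sound _ D S' _ hM' _ hprov ρ)

theorem rst_isSubsetFriendly : IsSubsetFriendly (systemRST L₀) :=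
  ⟨⟨subset_rfl, subset_rfl, subset_rfl, subset_rfl⟩, fun _ _ _ F h hF hu _ =>
    rst_separation h hF fun h => hu (free_subset_var F h)⟩

end Systems

end SetTh

theorem theorem4p6 (L₀ : FirstOrder.Language.{u, v}) :
    -- RST_ext is a subset-friendly theory and a conservative extension of RST
    SetTh.IsSubsetFriendly (SetTh.systemRSText L₀) ∧
    (SetTh.systemRST L₀).IsConservativeExtension (SetTh.systemRSText L₀) ∧
    -- provability of (a)-(e) in RST and in every subset-friendly theory
    SetTh.IsSubsetFriendly (SetTh.systemRST L₀) ∧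
    (∀ M : SetTh.System (SetTh.Sig L₀), M = SetTh.systemRST L₀ ∨ SetTh.IsSubsetFriendly M →
      ∀ x y z u v w : ℕ, [x, y, z, u, v, w].Nodup →
        (SetTh.separation x y u (SetTh.Form.neg (SetTh.mem y x)) ∈ M.provables ∧
          SetTh.emptySetExists u y ∈ M.provables) ∧
        SetTh.unionExists x y z u ∈ M.provables ∧
        SetTh.pairSetExists x y z u ∈ M.provables ∧
        SetTh.powerSetExists x z v w ∈ M.provables ∧
        SetTh.inductiveSetExists x y z v ∈ M.provables) ∧
    -- the axioms of ZFC other than replacement are provable in RST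
    (∀ F : SetTh.Form (SetTh.Sig L₀), SetTh.ZFCWithoutReplacement F →
      F ∈ (SetTh.systemRST L₀).provables) := by
  refine ⟨SetTh.rstext_isSubsetFriendly L₀, SetTh.rstext_isConservativeExtension L₀,
    SetTh.rst_isSubsetFriendly L₀, fun M hM x y z u v w h => ?_, fun F hF => SetTh.rst_zfc hF⟩
  have hext : (SetTh.systemRST L₀).provables ⊆ M.provables := by
    rcases hM with rfl | hM
    · exact subset_rfl
    · exact hM.1.2.2.2
  simp only [List.nodup_cons, List.mem_cons, List.not_mem_nil, or_false, not_or] at h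
  obtain ⟨⟨hxy, hxz, hxu, hxv, hxw⟩, ⟨hyz, hyu, hyv, hyw⟩, ⟨hzu, hzv, hzw⟩, ⟨huv, huw⟩, hvw, -⟩ := h
  refine ⟨⟨hext ?_, hext ?_⟩, hext ?_, hext ?_, hext ?_, hext ?_⟩
  · refine SetTh.rst_separation (by simp [*]) (SetTh.over_mem _ _) fun hu => ?_
    have hu' : u = y ∨ u = x := by
      simpa [SetTh.Form.free, SetTh.mem, SetTh.termVar, Fin.exists_fin_two] using hu
    exact hu'.elim (Ne.symm hyu) (Ne.symm hxu)
  · exact SetTh.rst_emptySetExists (by simp [Ne.symm hyu])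
  · exact SetTh.rst_unionExists (by simp [*])
  · exact SetTh.rst_pairSetExists (by simp [*])
  · exact SetTh.rst_powerSetExists (by simp [*])
  · exact SetTh.rst_inductiveSetExists (by simp [*])
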